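/- Fix a separable infinite-dimensional complex Hilbert space $L$ and put $\mathcal B=\mathcal B(L)$, $\mathcal K=\mathcal K(L)$ (the compact operators). For a complex linear space $E$ let $\mathcal K E=\mathcal K\otimes E$ be the algebraic tensor product, a $\mathcal B$-bimodule via $a\cdot(b\otimes x)\cdot c=abc\otimes x$. A quantum norm on $E$ is a norm $\|\cdot\|$ on $\mathcal K E$ such that $\|a\cdot u\|,\|u\cdot a\|\le\|a\|\,\|u\|$ for $a\in\mathcal B$, $u\in\mathcal K E$, and $\|u+v\|=\max\{\|u\|,\|v\|\}$ whenever there are orthogonal projections $P,Q\in\mathcal B$ with $PQ=0$, $P\cdot u=u=u\cdot P$ and $Q\cdot v=v=v\cdot Q$; a quantum space is a linear space with a quantum norm. A linear map $\varphi:E\to F$ of quantum spaces is a completely isometric isomorphism if $\mathbf 1_{\mathcal K}\otimes\varphi:\mathcal K E\to\mathcal K F$ is an isometric isomorphism. Let $\dot\otimes$ denote the Hilbert tensor product of Hilbert spaces and of bounded operators. For an injective linear map $I:E\to\mathcal B(H_1,K_1)$, with $H_1,K_1$ Hilbert spaces, the associated concrete quantum norm of $\sum_k a_k\otimes x_k\in\mathcal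 K E$ is the operator norm of $\sum_k a_k\dot\otimes I(x_k)\in\mathcal B(L\dot\otimes H_1,L\dot\otimes K_1)$. An operator space, i.e. a (not necessarily closed) linear subspace of some $\mathcal B(H_1,K_1)$, carries the concrete quantum norm associated with its inclusion. For a Hilbert space $H$ with conjugate space $\overline H$, the column space $H_c$ and the row space $H_r$ are $H$ with the concrete quantum norms associated with $I_c:H\to\mathcal B(\mathbb C,H)$, $I_c(x)(1)=x$, and $I_r:H\to\mathcal B(\overline H,\mathbb C)$, $I_r(x)(y)=\langle x,y\rangle$; through $I_c$ and $I_r$ they are regarded as operator spaces. For quantum spaces $E,F$, the Haagerup tensor product $E\otimes_h F$ is the algebraic tensor product $E\otimes F$ with the quantum norm $$\|U\|_h=\inf\Bigl\{\sum_{k=1}^n\|u_k\|\,\|v_k\| : U=\sum_{k=1}^n u_k\odot v_k,\ u_k\in\mathcal K E,\ v_k\in\mathcal K F\Bigr\},\qquad U\in\mathcal K(E\otimes F),$$ where $\odot:\mathcal K E\times\mathcal K F\to\mathcal K(E\otimes F)$ is the bilinear map with $(a\otimes x)\odot(b\otimes y)=ab\otimes(x\otimes y)$. For operator spaces $E\subseteq\mathcal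 B(H_1,K_1)$ and $F\subseteq\mathcal B(H_2,K_2)$, the spatial tensor product $E\otimes_{sp}F$ is $E\otimes F$ with the concrete quantum norm associated with the injective map $E\otimes F\to\mathcal B(H_1\dot\otimes H_2,K_1\dot\otimes K_2)$, $x\otimes y\mapsto x\dot\otimes y$. **Proposition 26.** Let $H$ be a Hilbert space and $E$ an arbitrary operator space. Then the identity maps $$\mathbf 1: H_c\otimes_h E\to H_c\otimes_{sp}E\qquad\text{and}\qquad \mathbf 1:E\otimes_h H_r\to E\otimes_{sp}H_r$$ are completely isometric isomorphisms of quantum spaces. -/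

import Mathlib

open scoped TensorProduct

noncomputable section

namespace QuantumSpaces

/-! ### Hilbert tensor products of Hilbert spaces and of bounded operators -/

/-- The Hilbert tensor product of two Hilbert spaces: the completion of the algebraic tensor
product with respect to `⟪a ⊗ b, c ⊗ d⟫ = ⟪a, c⟫ * ⟪b, d⟫`. -/
abbrev HTensor (H K : Type*) [NormedAddCommGroup H] [InnerProductSpace ℂ H]
    [NormedAddCommGroup K] [InnerProductSpace ℂ K] : Type _ :=
  UniformSpace.Completion (H ⊗[ℂ] K)

section OperatorTensor

variable {H₁ K₁ H₂ K₂ : Type*}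
  [NormedAddCommGroup H₁] [InnerProductSpace ℂ H₁] [NormedAddCommGroup K₁] [InnerProductSpace ℂ K₁]
  [NormedAddCommGroup H₂] [InnerProductSpace ℂ H₂] [NormedAddCommGroup K₂] [InnerProductSpace ℂ K₂]

/-- The Hilbert tensor product of two bounded operators: the bounded operator with
`ξ ⊗ η ↦ a ξ ⊗ b η`. -/
def opTensor (a : H₁ →L[ℂ] K₁) (b : H₂ →L[ℂ] K₂) : HTensor H₁ H₂ →L[ℂ] HTensor K₁ K₂ :=
  (TensorProduct.mapL a b).completion

theorem opTensor_coe (a : H₁ →L[ℂ] K₁) (b : H₂ →L[ℂ] K₂) (x : H₁ ⊗[ℂ] H₂) :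
    opTensor a b (x : HTensor H₁ H₂) = (TensorProduct.mapL a b x : K₁ ⊗[ℂ] K₂) :=
  ContinuousLinearMap.completion_apply_coe _ _

theorem ext_on_coe {f g : HTensor H₁ H₂ →L[ℂ] HTensor K₁ K₂}
    (h : ∀ x : H₁ ⊗[ℂ] H₂, f (x : HTensor H₁ H₂) = g (x : HTensor H₁ H₂)) : f = g :=
  ContinuousLinearMap.ext fun x =>
    UniformSpace.Completion.induction_on x (isClosed_eq f.continuous g.continuous) h

/-- The Hilbert tensor product of operators, as a bilinear map. -/
def opTensorₗ : (H₁ →L[ℂ] K₁) →ₗ[ℂ] (H₂ →L[ℂ] K₂) →ₗ[ℂ]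
    (HTensor H₁ H₂ →L[ℂ] HTensor K₁ K₂) :=
  LinearMap.mk₂ ℂ opTensor
    (fun a a' b => ext_on_coe fun x => by
      simp only [opTensor_coe, TensorProduct.mapL_add_left, add_apply,
        UniformSpace.Completion.coe_add])
    (fun c a b => ext_on_coe fun x => by
      simp only [opTensor_coe, TensorProduct.mapL_smul_left, smul_apply,
        UniformSpace.Completion.coe_smul])
    (fun a b b' => ext_on_coe fun x => by
      simp only [opTensor_coe, TensorProduct.mapL_add_right, add_apply,
        UniformSpace.Completion.coe_add])
    (fun c a b => ext_on_coe fun x => by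
      simp only [opTensor_coe, TensorProduct.mapL_smul_right, smul_apply,
        UniformSpace.Completion.coe_smul])

end OperatorTensor

/-! ### Amplifications -/

section Amplification

variable (L : Type*) [NormedAddCommGroup L] [InnerProductSpace ℂ L]

/-- The compact operators on `L`. -/
abbrev Cpt : Submodule ℂ (L →L[ℂ] L) := compactOperator (RingHom.id ℂ) L L

variable {L}

/-- `b ↦ a b` on compact operators, for a bounded `a`. -/
def cptMulLeft (a : L →L[ℂ] L) : Cpt L →ₗ[ℂ] Cpt L where
  toFun b := ⟨a ∘L (b : L →L[ℂ] L), IsCompactOperator.clm_comp b.2 a⟩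
  map_add' b c := Subtype.ext (by simp)
  map_smul' r b := Subtype.ext (by simp)

/-- `b ↦ b a` on compact operators, for a bounded `a`. -/
def cptMulRight (a : L →L[ℂ] L) : Cpt L →ₗ[ℂ] Cpt L where
  toFun b := ⟨(b : L →L[ℂ] L) ∘L a, IsCompactOperator.comp_clm b.2 a⟩
  map_add' b c := Subtype.ext (by simp)
  map_smul' r b := Subtype.ext (by simp)

variable (L) in
/-- The multiplication of compact operators, as a bilinear map. -/
def cptMul : Cpt L →ₗ[ℂ] Cpt L →ₗ[ℂ] Cpt L :=
  LinearMap.mk₂ ℂ (fun a b => cptMulLeft (a : L →L[ℂ] L) b)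
    (fun a a' b => Subtype.ext (by simp [cptMulLeft]))
    (fun c a b => Subtype.ext (by simp [cptMulLeft]))
    (fun a b b' => map_add _ _ _)
    (fun c a b => map_smul _ _ _)

variable (L) in
/-- The amplification of a linear space: the algebraic tensor product with the compact operators. -/
abbrev Amp (E : Type*) [AddCommGroup E] [Module ℂ E] : Type _ := Cpt L ⊗[ℂ] E

variable {E F : Type*} [AddCommGroup E] [Module ℂ E] [AddCommGroup F] [Module ℂ F]

/-- The left outer multiplication `a · (b ⊗ x) = (a b) ⊗ x`. -/
def leftAct (a : L →L[ℂ] L) : Amp L E →ₗ[ℂ] Amp L E := (cptMulLeft a).rTensor E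

/-- The right outer multiplication `(b ⊗ x) · a = (b a) ⊗ x`. -/
def rightAct (a : L →L[ℂ] L) : Amp L E →ₗ[ℂ] Amp L E := (cptMulRight a).rTensor E

variable (L) in
/-- The amplification `a ⊗ x ↦ a ⊗ φ x` of a linear map `φ`. -/
def ampMap (φ : E →ₗ[ℂ] F) : Amp L E →ₗ[ℂ] Amp L F := φ.lTensor (Cpt L)

/-- `u` has support `P`: `P` is an orthogonal projection with `P · u = u = u · P`. -/
def IsSupport (P : L →L[ℂ] L) (u : Amp L E) : Prop :=
  P ∘L P = P ∧ (∀ ξ η : L, inner ℂ (P ξ) η = inner ℂ ξ (P η)) ∧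
    leftAct P u = u ∧ rightAct P u = u

/-- `N` is a quantum norm on `E`: a norm on the amplification of `E` which satisfies both
axioms of Ruan. -/
structure IsQuantumNorm (N : Amp L E → ℝ) : Prop where
  add_le : ∀ u v, N (u + v) ≤ N u + N v
  smul : ∀ (c : ℂ) u, N (c • u) = ‖c‖ * N u
  eq_zero : ∀ u, N u = 0 → u = 0
  leftAct_le : ∀ (a : L →L[ℂ] L) u, N (leftAct a u) ≤ ‖a‖ * N u
  rightAct_le : ∀ (a : L →L[ℂ] L) u, N (rightAct a u) ≤ ‖a‖ * N u
  add_eq_max : ∀ (P Q : L →L[ℂ] L) u v, IsSupport P u → IsSupport Q v → P ∘L Q = 0 →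
    N (u + v) = max (N u) (N v)

/-- `φ` is a completely isometric isomorphism between the quantum spaces `(E, N)` and `(F, M)`:
its amplification is an isometric isomorphism. -/
structure IsCompletelyIsometricIso (N : Amp L E → ℝ) (M : Amp L F → ℝ) (φ : E →ₗ[ℂ] F) :
    Prop where
  source : IsQuantumNorm N
  target : IsQuantumNorm M
  bijective : Function.Bijective (ampMap L φ)
  isometric : ∀ u, M (ampMap L φ u) = N u

/-! ### The Haagerup norm -/

variable (L E F) in
/-- The Effros symbol: the bilinear map with `(a ⊗ x) ⊙ (b ⊗ y) = (a b) ⊗ (x ⊗ y)`. -/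
def effros : Amp L E →ₗ[ℂ] Amp L F →ₗ[ℂ] Amp L (E ⊗[ℂ] F) :=
  TensorProduct.map₂ (cptMul L) (TensorProduct.mk ℂ E F)

/-- The Haagerup norm of `U`: the infimum of `∑ k, ‖u k‖ * ‖v k‖` over all representations
`U = ∑ k, u k ⊙ v k`. -/
def haagerupNorm (N : Amp L E → ℝ) (M : Amp L F → ℝ) (U : Amp L (E ⊗[ℂ] F)) : ℝ :=
  sInf {r : ℝ | ∃ (n : ℕ) (u : Fin n → Amp L E) (v : Fin n → Amp L F),
    U = ∑ k, effros L E F (u k) (v k) ∧ r = ∑ k, N (u k) * M (v k)}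

/-! ### Concrete quantum norms and the spatial tensor product -/

variable {H₁ K₁ H₂ K₂ : Type*}
  [NormedAddCommGroup H₁] [InnerProductSpace ℂ H₁] [NormedAddCommGroup K₁] [InnerProductSpace ℂ K₁]
  [NormedAddCommGroup H₂] [InnerProductSpace ℂ H₂] [NormedAddCommGroup K₂] [InnerProductSpace ℂ K₂]

variable (L) in
/-- The linear map `a ⊗ x ↦ a ⊗ I x` into the bounded operators, for `I : E → B(H₁, K₁)`. -/
def ampOp (I : E →ₗ[ℂ] (H₁ →L[ℂ] K₁)) :
    Amp L E →ₗ[ℂ] (HTensor L H₁ →L[ℂ] HTensor L K₁) :=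
  TensorProduct.lift (opTensorₗ.compl₁₂ (Cpt L).subtype I)

variable (L) in
/-- The concrete quantum norm associated with an injective `I : E → B(H₁, K₁)`. -/
def concreteNorm (I : E →ₗ[ℂ] (H₁ →L[ℂ] K₁)) (u : Amp L E) : ℝ := ‖ampOp L I u‖

/-- The linear map `x ⊗ y ↦ I x ⊗ J y` which identifies the algebraic tensor product `E ⊗ F` with
the spatial tensor product `span {I x ⊗ J y}` in the bounded operators. -/
def spatialEmb (I : E →ₗ[ℂ] (H₁ →L[ℂ] K₁)) (J : F →ₗ[ℂ] (H₂ →L[ℂ] K₂)) :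
    E ⊗[ℂ] F →ₗ[ℂ] (HTensor H₁ H₂ →L[ℂ] HTensor K₁ K₂) :=
  TensorProduct.lift (opTensorₗ.compl₁₂ I J)

theorem range_spatialEmb (I : E →ₗ[ℂ] (H₁ →L[ℂ] K₁)) (J : F →ₗ[ℂ] (H₂ →L[ℂ] K₂)) :
    LinearMap.range (spatialEmb I J) =
      Submodule.span ℂ {T | ∃ x y, T = opTensor (I x) (J y)} := by
  rw [LinearMap.range_eq_map, ← TensorProduct.span_tmul_eq_top, Submodule.map_span]
  congr 1
  ext T
  constructor
  · rintro ⟨_, ⟨x, y, rfl⟩, rfl⟩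
    exact ⟨x, y, rfl⟩
  · rintro ⟨x, y, rfl⟩
    exact ⟨x ⊗ₜ y, ⟨x, y, rfl⟩, rfl⟩

variable (L) in
/-- The quantum norm of the spatial tensor product of the operator spaces `I(E)` and `J(F)`. -/
def spatialNorm (I : E →ₗ[ℂ] (H₁ →L[ℂ] K₁)) (J : F →ₗ[ℂ] (H₂ →L[ℂ] K₂)) :
    Amp L (E ⊗[ℂ] F) → ℝ :=
  concreteNorm L (spatialEmb I J)

end Amplification

/-! ### The complex-conjugate Hilbert space -/

/-- The complex-conjugate space of a Hilbert space: the same additive group and norm, with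
`c • x` and `⟪x, y⟫` being `conj c • x` and `⟪y, x⟫` of the original space. -/
def ConjSpace (H : Type*) : Type _ := H

namespace ConjSpace

variable {H : Type*} [NormedAddCommGroup H]

instance : NormedAddCommGroup (ConjSpace H) := inferInstanceAs (NormedAddCommGroup H)

instance [CompleteSpace H] : CompleteSpace (ConjSpace H) := inferInstanceAs (CompleteSpace H)

/-- The identity map from the conjugate space to the original one. -/
def toOrig : ConjSpace H ≃+ H := AddEquiv.refl H

theorem norm_toOrig (x : ConjSpace H) : ‖toOrig x‖ = ‖x‖ := rfl

variable [InnerProductSpace ℂ H]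

instance : Module ℂ (ConjSpace H) := Module.compHom H (starRingEnd ℂ)

theorem toOrig_smul (c : ℂ) (x : ConjSpace H) :
    toOrig (c • x) = starRingEnd ℂ c • toOrig x := rfl

instance : NormedSpace ℂ (ConjSpace H) where
  norm_smul_le c x := by
    rw [← norm_toOrig, toOrig_smul, norm_smul, RCLike.norm_conj, norm_toOrig]

instance : InnerProductSpace ℂ (ConjSpace H) where
  inner x y := inner ℂ (toOrig y) (toOrig x)
  norm_sq_eq_re_inner x := by
    rw [← norm_toOrig]
    exact norm_sq_eq_re_inner (𝕜 := ℂ) (toOrig x)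
  conj_inner_symm x y := inner_conj_symm (toOrig y) (toOrig x)
  add_left x y z := by
    rw [map_add, inner_add_right]
  smul_left x y c := by
    rw [toOrig_smul, inner_smul_right]

end ConjSpace

/-! ### Column and row Hilbertians -/

section Hilbertians

variable (L : Type*) [NormedAddCommGroup L] [InnerProductSpace ℂ L]
variable (H : Type*) [NormedAddCommGroup H] [InnerProductSpace ℂ H]

/-- The column embedding `H → B(ℂ, H)`, taking `x` to the operator `1 ↦ x`. -/
def columnEmb : H →ₗ[ℂ] (ℂ →L[ℂ] H) where
  toFun x := ContinuousLinearMap.toSpanSingleton ℂ x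
  map_add' x y := by ext; simp
  map_smul' c x := by ext; simp

/-- The functional `y ↦ ⟪x, y⟫` on the conjugate space (the inner product being linear in `x`,
which is the second argument of Mathlib's `inner`). -/
def rowFunctional (x : H) : ConjSpace H →L[ℂ] ℂ :=
  LinearMap.mkContinuous
    { toFun := fun y => inner ℂ (ConjSpace.toOrig y) x
      map_add' := fun y z => by rw [map_add, inner_add_left]
      map_smul' := fun c y => by
        rw [ConjSpace.toOrig_smul, inner_smul_left, Complex.conj_conj]
        rfl }
    ‖x‖ (fun y => by
      rw [mul_comm, ← ConjSpace.norm_toOrig]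
      exact norm_inner_le_norm _ _)

theorem rowFunctional_apply (x : H) (y : ConjSpace H) :
    rowFunctional H x y = inner ℂ (ConjSpace.toOrig y) x := rfl

/-- The row embedding of `H` into the functionals on the conjugate space, taking `x` to the
functional `y ↦ ⟪x, y⟫`. -/
def rowEmb : H →ₗ[ℂ] (ConjSpace H →L[ℂ] ℂ) where
  toFun x := rowFunctional H x
  map_add' x y := by ext z; simp [rowFunctional_apply]
  map_smul' c x := by ext z; simp [rowFunctional_apply]

/-- The quantum norm of the column Hilbertian. -/
def columnNorm : Amp L H → ℝ := concreteNorm L (columnEmb H)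

/-- The quantum norm of the row Hilbertian. -/
def rowNorm : Amp L H → ℝ := concreteNorm L (rowEmb H)

variable {H₁ K₁ : Type*}
  [NormedAddCommGroup H₁] [InnerProductSpace ℂ H₁] [NormedAddCommGroup K₁] [InnerProductSpace ℂ K₁]

/-- The standard quantum norm of an operator space, that is, of a (not necessarily closed)
subspace of `B(H₁, K₁)`. -/
def standardNorm (E : Submodule ℂ (H₁ →L[ℂ] K₁)) : Amp L E → ℝ := concreteNorm L E.subtype

end Hilbertians

end QuantumSpaces

end

/-!
For concrete operator spaces the Haagerup norm dominates the spatial norm, because the spatial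
operator of an Effros symbol factors: `a b ⊗ (I x ⊗ J y) = (a ⊗ (I x ⊗ 1)) (b ⊗ (1 ⊗ J y))`, and
tensoring with an identity operator does not increase norms (`ampOp_spatialEmb_effros`,
`spatialNorm_effros_le`).

For the converse in the case `H_c ⊗ E`, write `U = ∑ eᵢ ⊗ wᵢ` with orthonormal `eᵢ ∈ H` and
`wᵢ ∈ 𝒦 ⊗ E`. The spatial norm of `U` is the norm of the column of the operators of the `wᵢ`. As `L`
is infinite-dimensional, there are isometries `Sᵢ` of `L` with `Sᵢ⋆ Sⱼ = δᵢⱼ`, and the column has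
the same norm as the single element `∑ Sᵢ wᵢ` of `𝒦 ⊗ E`. Formally `U = (∑ Sᵢ⋆ ⊗ eᵢ) ⊙ (∑ Sᵢ wᵢ)`,
where the first factor is a contraction by Bessel's inequality, but `Sᵢ⋆` is not compact. This is repaired
by a factorization of Cohen type: finitely many compact operators `a` can be written as `a = b a'`
with a common compact contraction `b` and with `a'` as close to `a` as desired
(`exists_common_left_factor`). Hence `wᵢ = b (wᵢ + rᵢ)` with small `rᵢ`, and
`U = (∑ b Sᵢ⋆ ⊗ eᵢ) ⊙ (∑ Sᵢ (wᵢ + rᵢ))` has cost at most the spatial norm plus `ε`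
(`haagerupNorm_column`). The case `E ⊗ H_r` is the mirror image, with `wᵢ = (wᵢ + rᵢ) b` and
`U = (∑ (wᵢ + rᵢ) Sᵢ⋆) ⊙ (∑ Sᵢ b ⊗ eᵢ)` (`haagerupNorm_row`).

Both norms being equal, the Haagerup norm is a quantum norm because the spatial norm is one, which
holds for every concrete norm (`isQuantumNorm_concreteNorm`); that the concrete norms vanish only at
zero rests on the injectivity of `x ⊗ y ↦ I x ⊗ J y` (`spatialEmb_injective`).
-/

noncomputable section

namespace QuantumSpaces

/-! ### Hilbert tensor products of vectors and operators -/

section HTensor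

variable {H K H₁ K₁ H₂ K₂ H₃ K₃ X Y : Type*}
  [NormedAddCommGroup H] [InnerProductSpace ℂ H] [NormedAddCommGroup K] [InnerProductSpace ℂ K]
  [NormedAddCommGroup H₁] [InnerProductSpace ℂ H₁] [NormedAddCommGroup K₁] [InnerProductSpace ℂ K₁]
  [NormedAddCommGroup H₂] [InnerProductSpace ℂ H₂] [NormedAddCommGroup K₂] [InnerProductSpace ℂ K₂]
  [NormedAddCommGroup H₃] [InnerProductSpace ℂ H₃] [NormedAddCommGroup K₃] [InnerProductSpace ℂ K₃]
  [NormedAddCommGroup X] [InnerProductSpace ℂ X] [NormedAddCommGroup Y] [NormedSpace ℂ Y]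

/-- The elementary tensor `x ⊗ y`, as a vector of the Hilbert tensor product. -/
def htmul (x : H) (y : K) : HTensor H K := ((x ⊗ₜ[ℂ] y : H ⊗[ℂ] K) : HTensor H K)

theorem inner_htmul (x x' : H) (y y' : K) :
    inner ℂ (htmul x y) (htmul x' y') = inner ℂ x x' * inner ℂ y y' := by
  rw [htmul, htmul, UniformSpace.Completion.inner_coe, TensorProduct.inner_tmul]

theorem norm_htmul (x : H) (y : K) : ‖htmul x y‖ = ‖x‖ * ‖y‖ := by
  rw [htmul, UniformSpace.Completion.norm_coe, TensorProduct.norm_tmul]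

theorem opTensor_htmul (a : H₁ →L[ℂ] K₁) (b : H₂ →L[ℂ] K₂) (x : H₁) (y : H₂) :
    opTensor a b (htmul x y) = htmul (a x) (b y) := by
  rw [htmul, opTensor_coe]; rfl

/-- The bounded operator `y ↦ x ⊗ y`. -/
def htmulLeft (x : H) : K →L[ℂ] HTensor H K :=
  (UniformSpace.Completion.toComplL (𝕜 := ℂ) (E := H ⊗[ℂ] K)).comp (TensorProduct.mkL ℂ H K x)

theorem htmulLeft_apply (x : H) (y : K) : htmulLeft x y = htmul x y := rfl

/-- The bounded operator `x ↦ x ⊗ y`. -/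
def htmulRight (y : K) : H →L[ℂ] HTensor H K :=
  (UniformSpace.Completion.toComplL (𝕜 := ℂ) (E := H ⊗[ℂ] K)).comp
    ((TensorProduct.mkL ℂ H K).flip y)

theorem htmulRight_apply (x : H) (y : K) : htmulRight y x = htmul x y := rfl

/-- Continuous linear maps on a Hilbert tensor product are determined by elementary tensors. -/
theorem hom_ext {f g : HTensor H K →L[ℂ] Y} (h : ∀ x y, f (htmul x y) = g (htmul x y)) : f = g := by
  refine ContinuousLinearMap.ext fun z =>
    UniformSpace.Completion.induction_on z (isClosed_eq f.continuous g.continuous) fun z => ?_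
  induction z using TensorProduct.induction_on with
  | zero => rw [UniformSpace.Completion.coe_zero, map_zero, map_zero]
  | tmul x y => exact h x y
  | add a b ha hb => rw [UniformSpace.Completion.coe_add, map_add, map_add, ha, hb]

/-- A relation between inner products which holds on elementary tensors holds everywhere. -/
theorem inner_map_map_eq {f g : HTensor H K →L[ℂ] X} {c : ℂ}
    (h : ∀ x y x' y', inner ℂ (f (htmul x y)) (g (htmul x' y')) = c * (inner ℂ x x' * inner ℂ y y'))
    (z w : HTensor H K) : inner ℂ (f z) (g w) = c * inner ℂ z w := by
  refine UniformSpace.Completion.induction_on₂ z w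
    (isClosed_eq (by fun_prop) (by fun_prop)) fun z w => ?_
  induction z using TensorProduct.induction_on with
  | zero =>
    rw [UniformSpace.Completion.coe_zero, map_zero, inner_zero_left, inner_zero_left, mul_zero]
  | add a b ha hb =>
    rw [UniformSpace.Completion.coe_add, map_add, inner_add_left, inner_add_left, ha, hb, mul_add]
  | tmul x y =>
    induction w using TensorProduct.induction_on with
    | zero =>
      rw [UniformSpace.Completion.coe_zero, map_zero, inner_zero_right, inner_zero_right, mul_zero]
    | add a b ha hb =>
      rw [UniformSpace.Completion.coe_add, map_add, inner_add_right, inner_add_right, ha, hb,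
        mul_add]
    | tmul x' y' =>
      have := h x y x' y'
      rwa [← inner_htmul] at this

theorem inner_opTensor_opTensor {a a' : H₁ →L[ℂ] K₁} {b b' : H₂ →L[ℂ] K₂} {c : ℂ}
    (h : ∀ x y x' y', inner ℂ (a x) (a' x') * inner ℂ (b y) (b' y') =
      c * (inner ℂ x x' * inner ℂ y y')) (z w : HTensor H₁ H₂) :
    inner ℂ (opTensor a b z) (opTensor a' b' w) = c * inner ℂ z w :=
  inner_map_map_eq (fun x y x' y' => by
    rw [opTensor_htmul, opTensor_htmul, inner_htmul, h]) z w

theorem norm_opTensor_le (a : H₁ →L[ℂ] K₁) (b : H₂ →L[ℂ] K₂) : ‖opTensor a b‖ ≤ ‖a‖ * ‖b‖ := by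
  refine ContinuousLinearMap.opNorm_le_bound _ (by positivity) fun z =>
    UniformSpace.Completion.induction_on z (isClosed_le (by fun_prop) (by fun_prop)) fun z => ?_
  rw [opTensor_coe, UniformSpace.Completion.norm_coe, UniformSpace.Completion.norm_coe]
  exact (ContinuousLinearMap.le_opNorm _ _).trans
    (mul_le_mul_of_nonneg_right (TensorProduct.norm_mapL_le a b) (norm_nonneg _))

theorem opTensor_comp (a : H₂ →L[ℂ] H₃) (a' : H₁ →L[ℂ] H₂) (b : K₂ →L[ℂ] K₃) (b' : K₁ →L[ℂ] K₂) :
    opTensor (a ∘L a') (b ∘L b') = opTensor a b ∘L opTensor a' b' :=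
  hom_ext fun x y => by simp [opTensor_htmul]

theorem opTensor_comp_apply (a : H₂ →L[ℂ] H₃) (a' : H₁ →L[ℂ] H₂) (b : K₂ →L[ℂ] K₃)
    (b' : K₁ →L[ℂ] K₂) (z : HTensor H₁ K₁) :
    opTensor a b (opTensor a' b' z) = opTensor (a ∘L a') (b ∘L b') z := by
  rw [opTensor_comp]; rfl

theorem opTensor_add_left (a a' : H₁ →L[ℂ] K₁) (b : H₂ →L[ℂ] K₂) :
    opTensor (a + a') b = opTensor a b + opTensor a' b :=
  ext_on_coe fun x => by
    simp only [opTensor_coe, TensorProduct.mapL_add_left, add_apply,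
      UniformSpace.Completion.coe_add]

theorem opTensor_add_right (a : H₁ →L[ℂ] K₁) (b b' : H₂ →L[ℂ] K₂) :
    opTensor a (b + b') = opTensor a b + opTensor a b' :=
  ext_on_coe fun x => by
    simp only [opTensor_coe, TensorProduct.mapL_add_right, add_apply,
      UniformSpace.Completion.coe_add]

theorem opTensor_smul_left (c : ℂ) (a : H₁ →L[ℂ] K₁) (b : H₂ →L[ℂ] K₂) :
    opTensor (c • a) b = c • opTensor a b :=
  ext_on_coe fun x => by
    simp only [opTensor_coe, TensorProduct.mapL_smul_left, smul_apply,
      UniformSpace.Completion.coe_smul]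

theorem opTensor_smul_right (c : ℂ) (a : H₁ →L[ℂ] K₁) (b : H₂ →L[ℂ] K₂) :
    opTensor a (c • b) = c • opTensor a b :=
  ext_on_coe fun x => by
    simp only [opTensor_coe, TensorProduct.mapL_smul_right, smul_apply,
      UniformSpace.Completion.coe_smul]

theorem opTensor_zero_left (b : H₂ →L[ℂ] K₂) : opTensor (0 : H₁ →L[ℂ] K₁) b = 0 :=
  ext_on_coe fun x => by
    rw [opTensor_coe, TensorProduct.mapL_zero_left, zero_apply, zero_apply,
      UniformSpace.Completion.coe_zero]

theorem opTensor_zero_right (a : H₁ →L[ℂ] K₁) : opTensor a (0 : H₂ →L[ℂ] K₂) = 0 :=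
  ext_on_coe fun x => by
    rw [opTensor_coe, TensorProduct.mapL_zero_right, zero_apply, zero_apply,
      UniformSpace.Completion.coe_zero]

theorem norm_opTensor_id_le (a : H₁ →L[ℂ] K₁) : ‖opTensor a (.id ℂ K)‖ ≤ ‖a‖ :=
  (norm_opTensor_le _ _).trans
    (mul_le_of_le_one_right (norm_nonneg _) ContinuousLinearMap.norm_id_le)

theorem norm_id_opTensor_le (b : H₁ →L[ℂ] K₁) : ‖opTensor (.id ℂ K) b‖ ≤ ‖b‖ :=
  (norm_opTensor_le _ _).trans
    (mul_le_of_le_one_left (norm_nonneg _) ContinuousLinearMap.norm_id_le)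

theorem adjoint_opTensor [CompleteSpace H₁] [CompleteSpace K₁] [CompleteSpace H₂] [CompleteSpace K₂]
    (a : H₁ →L[ℂ] K₁) (b : H₂ →L[ℂ] K₂) :
    (opTensor a b).adjoint = opTensor a.adjoint b.adjoint := by
  refine hom_ext fun x y => ?_
  refine ext_inner_right ℂ fun v => ?_
  have : (innerSL ℂ ((opTensor a b).adjoint (htmul x y))) =
      innerSL ℂ (opTensor a.adjoint b.adjoint (htmul x y)) := hom_ext fun x' y' => by
    simp only [innerSL_apply_apply, ContinuousLinearMap.adjoint_inner_left, opTensor_htmul,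
      inner_htmul]
  exact congrArg (fun f => f v) this

/-- A bilinear map which preserves inner products of elementary tensors extends to an isometry of
the Hilbert tensor product. -/
theorem exists_isometry_of_bilinear [CompleteSpace X] (B : H →ₗ[ℂ] K →ₗ[ℂ] X)
    (hB : ∀ x y x' y', inner ℂ (B x y) (B x' y') = inner ℂ x x' * inner ℂ y y') :
    ∃ T : HTensor H K →ₗᵢ[ℂ] X, ∀ x y, T (htmul x y) = B x y := by
  have hin : ∀ z w : H ⊗[ℂ] K,
      inner ℂ (TensorProduct.lift B z) (TensorProduct.lift B w) = inner ℂ z w := by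
    intro z w
    induction z using TensorProduct.induction_on with
    | zero => simp
    | add a b ha hb => rw [map_add, inner_add_left, inner_add_left, ha, hb]
    | tmul x y =>
      induction w using TensorProduct.induction_on with
      | zero => simp
      | add a b ha hb => rw [map_add, inner_add_right, inner_add_right, ha, hb]
      | tmul x' y' => simp [hB]
  have hn : ∀ z : H ⊗[ℂ] K, ‖TensorProduct.lift B z‖ = ‖z‖ := fun z => by
    rw [@norm_eq_sqrt_re_inner ℂ, hin]
    exact (norm_eq_sqrt_re_inner (𝕜 := ℂ) z).symm
  let e : H ⊗[ℂ] K →ₗ[ℂ] HTensor H K :=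
    (UniformSpace.Completion.toComplL (𝕜 := ℂ) (E := H ⊗[ℂ] K)).toLinearMap
  have hd : DenseRange e := UniformSpace.Completion.denseRange_coe
  have hb : ∃ C : ℝ, ∀ z, ‖TensorProduct.lift B z‖ ≤ C * ‖e z‖ :=
    ⟨1, fun z => by
      rw [one_mul, hn]; exact (UniformSpace.Completion.norm_coe z).ge⟩
  have hT := LinearMap.extendOfNorm_eq hd hb
  refine ⟨⟨((TensorProduct.lift B).extendOfNorm e).toLinearMap, fun z => ?_⟩, fun x y =>
    (hT (x ⊗ₜ y)).trans (TensorProduct.lift.tmul x y)⟩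
  refine UniformSpace.Completion.induction_on z (isClosed_eq
    (continuous_norm.comp ((TensorProduct.lift B).extendOfNorm e).continuous) continuous_norm)
    fun z => ?_
  exact (congrArg norm (hT z)).trans ((hn z).trans (UniformSpace.Completion.norm_coe z).symm)

/-- The map `x ⊗ y ↦ I x ⊗ J y` into operators is injective when `I` and `J` are. -/
theorem spatialEmb_injective {E F : Type*} [AddCommGroup E] [Module ℂ E] [AddCommGroup F]
    [Module ℂ F] {I : E →ₗ[ℂ] (H₁ →L[ℂ] K₁)} {J : F →ₗ[ℂ] (H₂ →L[ℂ] K₂)}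
    (hI : Function.Injective I) (hJ : Function.Injective J) :
    Function.Injective (spatialEmb I J) := by
  rw [injective_iff_map_eq_zero]
  intro z hz
  -- slicing the operator of `z` by `T ↦ ⟪x', T x⟫` in the first factor amounts to slicing `z`
  have key : ∀ (x : H₁) (x' : K₁) (z : E ⊗[ℂ] F) (y : H₂) (y' : K₂),
      inner ℂ (htmul x' y') (spatialEmb I J z (htmul x y)) =
        inner ℂ y' (J (TensorProduct.lid ℂ F (LinearMap.rTensor F
          ((innerSL ℂ x').toLinearMap ∘ₗ
            (ContinuousLinearMap.apply ℂ K₁ x).toLinearMap ∘ₗ I) z)) y) := by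
    intro x x' z y y'
    induction z using TensorProduct.induction_on with
    | zero => simp
    | add a b ha hb => simp only [map_add, add_apply, inner_add_right, ha, hb]
    | tmul p q =>
      simp [spatialEmb, opTensorₗ, opTensor_htmul, inner_htmul]
  classical
  let 𝒞 := Module.Basis.ofVectorSpace ℂ F
  apply (TensorProduct.equivFinsuppOfBasisRight (M := E) 𝒞).injective
  rw [map_zero]
  ext i
  apply hI
  rw [Finsupp.zero_apply, map_zero]
  ext x
  refine ext_inner_left ℂ fun x' => ?_
  set ω : E →ₗ[ℂ] ℂ :=
    (innerSL ℂ x').toLinearMap ∘ₗ (ContinuousLinearMap.apply ℂ K₁ x).toLinearMap ∘ₗ I with hω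
  have h0 : TensorProduct.lid ℂ F (LinearMap.rTensor F ω z) = 0 := by
    apply hJ
    rw [map_zero]
    ext y
    refine ext_inner_left ℂ fun y' => ?_
    rw [← key x x' z y y', hz]
    simp
  have hcoord : ∀ z : E ⊗[ℂ] F, 𝒞.repr (TensorProduct.lid ℂ F (LinearMap.rTensor F ω z)) i =
      ω (TensorProduct.equivFinsuppOfBasisRight (M := E) 𝒞 z i) := by
    intro z
    induction z using TensorProduct.induction_on with
    | zero => simp
    | add a b ha hb => simp only [map_add, Finsupp.add_apply, ha, hb]
    | tmul p q =>
      simp [mul_comm]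
  have := hcoord z
  rw [h0] at this
  simpa [hω] using this.symm

end HTensor

/-! ### Concrete quantum norms satisfy Ruan's axioms -/

section OrthogonalSum

variable {A B : Type*} [NormedAddCommGroup A] [InnerProductSpace ℂ A] [CompleteSpace A]
  [NormedAddCommGroup B] [InnerProductSpace ℂ B] [CompleteSpace B]

/-- Bessel's inequality for two orthogonal projections with orthogonal ranges. -/
theorem norm_sq_add_norm_sq_le {P Q : A →L[ℂ] A} (hP : P.adjoint = P) (hQ : Q.adjoint = Q)
    (hPP : P ∘L P = P) (hQQ : Q ∘L Q = Q) (hPQ : P ∘L Q = 0) (x : A) :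
    ‖P x‖ ^ 2 + ‖Q x‖ ^ 2 ≤ ‖x‖ ^ 2 := by
  have sP : ∀ y z, inner ℂ (P y) z = inner ℂ y (P z) := fun y z => by
    rw [← ContinuousLinearMap.adjoint_inner_left, hP]
  have sQ : ∀ y z, inner ℂ (Q y) z = inner ℂ y (Q z) := fun y z => by
    rw [← ContinuousLinearMap.adjoint_inner_left, hQ]
  have aPP : ∀ y, P (P y) = P y := fun y => congrArg (fun f => f y) hPP
  have aQQ : ∀ y, Q (Q y) = Q y := fun y => congrArg (fun f => f y) hQQ
  have aPQ : ∀ y, P (Q y) = 0 := fun y => congrArg (fun f => f y) hPQ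
  have h1 : ‖P x + Q x‖ ^ 2 = ‖P x‖ ^ 2 + ‖Q x‖ ^ 2 := by
    rw [sq, sq, sq]
    exact norm_add_sq_eq_norm_sq_add_norm_sq_of_inner_eq_zero (𝕜 := ℂ) _ _ (by
      rw [sP, aPQ, inner_zero_right])
  have h2 : ‖P x‖ ^ 2 + ‖Q x‖ ^ 2 = RCLike.re (inner ℂ x (P x + Q x)) := by
    rw [inner_add_right, map_add, ← aPP x, ← aQQ x, ← sP, ← sQ, aPP, aQQ,
      inner_self_eq_norm_sq (𝕜 := ℂ), inner_self_eq_norm_sq (𝕜 := ℂ)]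
  have h3 : RCLike.re (inner ℂ x (P x + Q x)) ≤ ‖x‖ * ‖P x + Q x‖ := re_inner_le_norm _ _
  have h4 : ‖P x + Q x‖ ≤ ‖x‖ := by
    by_contra! h
    nlinarith [norm_nonneg x]
  nlinarith [norm_nonneg x, norm_nonneg (P x + Q x)]

/-- An operator which is block diagonal with respect to two orthogonal pairs of projections has
norm the maximum of the norms of the blocks. -/
theorem norm_add_eq_max_of_orthogonal {X Y : A →L[ℂ] B} {P Q : A →L[ℂ] A} {P' Q' : B →L[ℂ] B}
    (hP : P.adjoint = P) (hQ : Q.adjoint = Q) (hPP : P ∘L P = P) (hQQ : Q ∘L Q = Q)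
    (hPQ : P ∘L Q = 0) (hP' : P'.adjoint = P') (hPQ' : P' ∘L Q' = 0)
    (hPX : P' ∘L X = X) (hXP : X ∘L P = X) (hQY : Q' ∘L Y = Y) (hYQ : Y ∘L Q = Y) :
    ‖X + Y‖ = max ‖X‖ ‖Y‖ := by
  have aPX : ∀ y, P' (X y) = X y := fun y => congrArg (fun f => f y) hPX
  have aXP : ∀ y, X (P y) = X y := fun y => congrArg (fun f => f y) hXP
  have aQY : ∀ y, Q' (Y y) = Y y := fun y => congrArg (fun f => f y) hQY
  have aYQ : ∀ y, Y (Q y) = Y y := fun y => congrArg (fun f => f y) hYQ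
  have aPQ : ∀ y, P (Q y) = 0 := fun y => congrArg (fun f => f y) hPQ
  have aPQ' : ∀ y, P' (Q' y) = 0 := fun y => congrArg (fun f => f y) hPQ'
  have aQP : ∀ y, Q (P y) = 0 := by
    have h := congrArg ContinuousLinearMap.adjoint hPQ
    rw [ContinuousLinearMap.adjoint_comp, hP, hQ, map_zero] at h
    exact fun y => congrArg (fun f => f y) h
  have bessel := norm_sq_add_norm_sq_le hP hQ hPP hQQ hPQ
  have lP : ∀ x, ‖P x‖ ≤ ‖x‖ := fun x =>
    le_of_sq_le_sq (by nlinarith [bessel x, sq_nonneg ‖Q x‖]) (norm_nonneg _)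
  have lQ : ∀ x, ‖Q x‖ ≤ ‖x‖ := fun x =>
    le_of_sq_le_sq (by nlinarith [bessel x, sq_nonneg ‖P x‖]) (norm_nonneg _)
  apply le_antisymm
  · have hm : 0 ≤ max ‖X‖ ‖Y‖ := le_max_of_le_left (norm_nonneg _)
    refine ContinuousLinearMap.opNorm_le_bound _ hm fun x => ?_
    have h1 : ‖X x + Y x‖ ^ 2 = ‖X x‖ ^ 2 + ‖Y x‖ ^ 2 := by
      rw [sq, sq, sq]
      exact norm_add_sq_eq_norm_sq_add_norm_sq_of_inner_eq_zero (𝕜 := ℂ) _ _ (by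
        rw [← aPX, ← hP', ContinuousLinearMap.adjoint_inner_left, ← aQY, aPQ', inner_zero_right])
    have h2 : ‖X x‖ ≤ max ‖X‖ ‖Y‖ * ‖P x‖ := by
      rw [← aXP]
      exact (X.le_opNorm _).trans (by gcongr; exact le_max_left _ _)
    have h3 : ‖Y x‖ ≤ max ‖X‖ ‖Y‖ * ‖Q x‖ := by
      rw [← aYQ]
      exact (Y.le_opNorm _).trans (by gcongr; exact le_max_right _ _)
    refine le_of_sq_le_sq ?_ (by positivity)
    calc ‖(X + Y) x‖ ^ 2 = ‖X x‖ ^ 2 + ‖Y x‖ ^ 2 := h1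
      _ ≤ (max ‖X‖ ‖Y‖ * ‖P x‖) ^ 2 + (max ‖X‖ ‖Y‖ * ‖Q x‖) ^ 2 := by gcongr
      _ = max ‖X‖ ‖Y‖ ^ 2 * (‖P x‖ ^ 2 + ‖Q x‖ ^ 2) := by ring
      _ ≤ max ‖X‖ ‖Y‖ ^ 2 * ‖x‖ ^ 2 := by gcongr; exact bessel x
      _ = _ := by ring
  · refine max_le (ContinuousLinearMap.opNorm_le_bound _ (norm_nonneg _) fun x => ?_)
      (ContinuousLinearMap.opNorm_le_bound _ (norm_nonneg _) fun x => ?_)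
    · have : X x = (X + Y) (P x) := by
        rw [add_apply, aXP, ← aYQ, aQP, map_zero, add_zero]
      rw [this]
      exact ((X + Y).le_opNorm _).trans (by gcongr; exact lP x)
    · have : Y x = (X + Y) (Q x) := by
        rw [add_apply, aYQ, ← aXP, aPQ, map_zero, zero_add]
      rw [this]
      exact ((X + Y).le_opNorm _).trans (by gcongr; exact lQ x)

end OrthogonalSum

section Concrete

/-- A form of `norm_smul` for use on Hilbert tensor products, where instance synthesis does not find
`NormSMulClass` for the operators between completions. -/
theorem norm_smul_clm {A B : Type*} [NormedAddCommGroup A] [NormedSpace ℂ A] [NormedAddCommGroup B]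
    [NormedSpace ℂ B] (c : ℂ) (T : A →L[ℂ] B) : ‖c • T‖ = ‖c‖ * ‖T‖ :=
  norm_smul c T

variable {L : Type*} [NormedAddCommGroup L] [InnerProductSpace ℂ L]
variable {E F : Type*} [AddCommGroup E] [Module ℂ E] [AddCommGroup F] [Module ℂ F]
variable {H₁ K₁ H₂ K₂ : Type*}
  [NormedAddCommGroup H₁] [InnerProductSpace ℂ H₁] [NormedAddCommGroup K₁] [InnerProductSpace ℂ K₁]
  [NormedAddCommGroup H₂] [InnerProductSpace ℂ H₂] [NormedAddCommGroup K₂] [InnerProductSpace ℂ K₂]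

theorem ampOp_tmul (I : E →ₗ[ℂ] (H₁ →L[ℂ] K₁)) (a : Cpt L) (x : E) :
    ampOp L I (a ⊗ₜ x) = opTensor (a : L →L[ℂ] L) (I x) := rfl

theorem spatialEmb_tmul (I : E →ₗ[ℂ] (H₁ →L[ℂ] K₁)) (J : F →ₗ[ℂ] (H₂ →L[ℂ] K₂)) (x : E) (y : F) :
    spatialEmb I J (x ⊗ₜ y) = opTensor (I x) (J y) := rfl

theorem ampOp_injective {I : E →ₗ[ℂ] (H₁ →L[ℂ] K₁)} (hI : Function.Injective I) :
    Function.Injective (ampOp L I) :=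
  spatialEmb_injective (I := (Cpt L).subtype) Subtype.val_injective hI

theorem ampOp_leftAct (I : E →ₗ[ℂ] (H₁ →L[ℂ] K₁)) (a : L →L[ℂ] L) (u : Amp L E) :
    ampOp L I (leftAct a u) = opTensor a (.id ℂ K₁) ∘L ampOp L I u := by
  induction u using TensorProduct.induction_on with
  | zero => simp
  | add u v hu hv => simp only [map_add, hu, hv, ContinuousLinearMap.comp_add]
  | tmul b x =>
    rw [ampOp_tmul, ← opTensor_comp]
    rfl

theorem ampOp_rightAct (I : E →ₗ[ℂ] (H₁ →L[ℂ] K₁)) (a : L →L[ℂ] L) (u : Amp L E) :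
    ampOp L I (rightAct a u) = ampOp L I u ∘L opTensor a (.id ℂ H₁) := by
  induction u using TensorProduct.induction_on with
  | zero => simp
  | add u v hu hv => simp only [map_add, hu, hv, ContinuousLinearMap.add_comp]
  | tmul b x =>
    rw [ampOp_tmul, ← opTensor_comp]
    rfl

theorem concreteNorm_leftAct_le (I : E →ₗ[ℂ] (H₁ →L[ℂ] K₁)) (a : L →L[ℂ] L) (u : Amp L E) :
    concreteNorm L I (leftAct a u) ≤ ‖a‖ * concreteNorm L I u := by
  rw [concreteNorm, ampOp_leftAct]
  exact (ContinuousLinearMap.opNorm_comp_le _ _).trans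
    (mul_le_mul_of_nonneg_right (norm_opTensor_id_le a) (norm_nonneg _))

theorem concreteNorm_rightAct_le (I : E →ₗ[ℂ] (H₁ →L[ℂ] K₁)) (a : L →L[ℂ] L) (u : Amp L E) :
    concreteNorm L I (rightAct a u) ≤ ‖a‖ * concreteNorm L I u := by
  rw [concreteNorm, ampOp_rightAct, mul_comm]
  exact (ContinuousLinearMap.opNorm_comp_le _ _).trans
    (mul_le_mul_of_nonneg_left (norm_opTensor_id_le a) (norm_nonneg _))

theorem concreteNorm_nonneg (I : E →ₗ[ℂ] (H₁ →L[ℂ] K₁)) (u : Amp L E) : 0 ≤ concreteNorm L I u :=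
  norm_nonneg (ampOp L I u)

theorem concreteNorm_add_le (I : E →ₗ[ℂ] (H₁ →L[ℂ] K₁)) (u v : Amp L E) :
    concreteNorm L I (u + v) ≤ concreteNorm L I u + concreteNorm L I v := by
  rw [concreteNorm, map_add]
  exact norm_add_le (ampOp L I u) (ampOp L I v)

theorem concreteNorm_sum_le {ι : Type*} (s : Finset ι) (I : E →ₗ[ℂ] (H₁ →L[ℂ] K₁))
    (u : ι → Amp L E) : concreteNorm L I (∑ i ∈ s, u i) ≤ ∑ i ∈ s, concreteNorm L I (u i) := by
  rw [concreteNorm, map_sum]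
  exact norm_sum_le s fun i => ampOp L I (u i)

theorem concreteNorm_tmul_le (I : E →ₗ[ℂ] (H₁ →L[ℂ] K₁)) (a : Cpt L) (x : E) :
    concreteNorm L I (a ⊗ₜ x) ≤ ‖a‖ * ‖I x‖ := by
  rw [concreteNorm, ampOp_tmul]
  exact norm_opTensor_le _ _

/-- The concrete norm associated with an injective map satisfies Ruan's axioms. -/
theorem isQuantumNorm_concreteNorm [CompleteSpace L] [CompleteSpace H₁] [CompleteSpace K₁]
    {I : E →ₗ[ℂ] (H₁ →L[ℂ] K₁)} (hI : Function.Injective I) :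
    IsQuantumNorm (concreteNorm L I) where
  add_le := concreteNorm_add_le I
  smul c u := by rw [concreteNorm, map_smul]; exact norm_smul_clm c (ampOp L I u)
  eq_zero u hu := ampOp_injective hI ((norm_eq_zero.1 hu).trans (map_zero _).symm)
  leftAct_le := concreteNorm_leftAct_le I
  rightAct_le := concreteNorm_rightAct_le I
  add_eq_max P Q u v hP hQ hPQ := by
    obtain ⟨hPP, hPs, hPu, huP⟩ := hP
    obtain ⟨hQQ, hQs, hQv, hvQ⟩ := hQ
    have adj : ∀ {R : L →L[ℂ] L}, (∀ ξ η : L, inner ℂ (R ξ) η = inner ℂ ξ (R η)) →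
        R.adjoint = R := fun h =>
      ((ContinuousLinearMap.eq_adjoint_iff _ _).2 h).symm
    have sa : ∀ {R : L →L[ℂ] L} (M : Type _) [NormedAddCommGroup M] [InnerProductSpace ℂ M]
        [CompleteSpace M], R.adjoint = R →
        (opTensor R (.id ℂ M)).adjoint = opTensor R (.id ℂ M) := fun M _ _ _ h => by
      rw [adjoint_opTensor, h, ContinuousLinearMap.adjoint_id]
    rw [concreteNorm, map_add]
    refine norm_add_eq_max_of_orthogonal (P := opTensor P (.id ℂ H₁)) (Q := opTensor Q (.id ℂ H₁))
      (P' := opTensor P (.id ℂ K₁)) (Q' := opTensor Q (.id ℂ K₁)) (sa H₁ (adj hPs))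
      (sa H₁ (adj hQs)) ?_ ?_ ?_ (adjoint_opTensor _ _ |>.trans ?_) ?_ ?_ ?_ ?_ ?_
    · rw [← opTensor_comp, hPP]; rfl
    · rw [← opTensor_comp, hQQ]; rfl
    · rw [← opTensor_comp, hPQ]; exact opTensor_zero_left _
    · rw [adj hPs, ContinuousLinearMap.adjoint_id]
    · rw [← opTensor_comp, hPQ]; exact opTensor_zero_left _
    · rw [← ampOp_leftAct, hPu]
    · rw [← ampOp_rightAct, huP]
    · rw [← ampOp_leftAct, hQv]
    · rw [← ampOp_rightAct, hvQ]

theorem effros_tmul_tmul (a b : Cpt L) (x : E) (y : F) :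
    effros L E F (a ⊗ₜ x) (b ⊗ₜ y) = (cptMul L a b) ⊗ₜ (x ⊗ₜ y) := rfl

theorem coe_cptMul (a b : Cpt L) :
    ((cptMul L a b : Cpt L) : L →L[ℂ] L) = (a : L →L[ℂ] L) ∘L (b : L →L[ℂ] L) := rfl

end Concrete

/-! ### The Effros symbol is contractive for the spatial norm -/

section Multiplicativity

variable {L : Type*} [NormedAddCommGroup L] [InnerProductSpace ℂ L]
variable {E F : Type*} [AddCommGroup E] [Module ℂ E] [AddCommGroup F] [Module ℂ F]
variable {H M H₁ K₁ H₂ K₂ : Type*}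
  [NormedAddCommGroup H] [InnerProductSpace ℂ H] [NormedAddCommGroup M] [InnerProductSpace ℂ M]
  [NormedAddCommGroup H₁] [InnerProductSpace ℂ H₁] [NormedAddCommGroup K₁] [InnerProductSpace ℂ K₁]
  [NormedAddCommGroup H₂] [InnerProductSpace ℂ H₂] [NormedAddCommGroup K₂] [InnerProductSpace ℂ K₂]

theorem htmulLeft_add (x x' : H) :
    (htmulLeft (x + x') : M →L[ℂ] HTensor H M) = htmulLeft x + htmulLeft x' := by
  ext y
  simp [htmulLeft]

theorem htmulLeft_smul (c : ℂ) (x : H) :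
    (htmulLeft (c • x) : M →L[ℂ] HTensor H M) = c • htmulLeft x := by
  ext y
  simp [htmulLeft]

variable (L H M) in
/-- The inverse `ℓ ⊗ (h ⊗ m) ↦ (ℓ ⊗ h) ⊗ m` of the associator of Hilbert tensor products, as an
isometry. -/
theorem exists_assoc_isometry : ∃ T : HTensor L (HTensor H M) →ₗᵢ[ℂ] HTensor (HTensor L H) M,
    ∀ ℓ z, T (htmul ℓ z) = opTensor (htmulLeft ℓ) (.id ℂ M) z := by
  refine exists_isometry_of_bilinear (LinearMap.mk₂ ℂ
    (fun ℓ z => opTensor (htmulLeft (K := H) ℓ) (.id ℂ M) z)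
    (fun ℓ ℓ' z => by rw [htmulLeft_add, opTensor_add_left, add_apply])
    (fun c ℓ z => by rw [htmulLeft_smul, opTensor_smul_left, smul_apply])
    (fun ℓ z z' => map_add (opTensor (htmulLeft ℓ) (.id ℂ M)) z z')
    (fun c ℓ z => map_smul (opTensor (htmulLeft ℓ) (.id ℂ M)) c z)) fun ℓ z ℓ' z' => ?_
  refine inner_opTensor_opTensor (fun h m h' m' => ?_) z z'
  rw [htmulLeft_apply, htmulLeft_apply, inner_htmul, ContinuousLinearMap.id_apply,
    ContinuousLinearMap.id_apply, mul_assoc]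

variable (L H M) in
/-- The flip `ℓ ⊗ (h ⊗ m) ↦ h ⊗ (ℓ ⊗ m)` of the first two factors of a Hilbert tensor product, as an
isometry. -/
theorem exists_leftComm_isometry : ∃ T : HTensor L (HTensor H M) →ₗᵢ[ℂ] HTensor H (HTensor L M),
    ∀ ℓ z, T (htmul ℓ z) = opTensor (.id ℂ H) (htmulLeft ℓ) z := by
  refine exists_isometry_of_bilinear (LinearMap.mk₂ ℂ
    (fun ℓ z => opTensor (.id ℂ H) (htmulLeft (K := M) ℓ) z)
    (fun ℓ ℓ' z => by rw [htmulLeft_add, opTensor_add_right, add_apply])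
    (fun c ℓ z => by rw [htmulLeft_smul, opTensor_smul_right, smul_apply])
    (fun ℓ z z' => map_add (opTensor (.id ℂ H) (htmulLeft ℓ)) z z')
    (fun c ℓ z => map_smul (opTensor (.id ℂ H) (htmulLeft ℓ)) c z)) fun ℓ z ℓ' z' => ?_
  refine inner_opTensor_opTensor (fun h m h' m' => ?_) z z'
  rw [htmulLeft_apply, htmulLeft_apply, inner_htmul, ContinuousLinearMap.id_apply,
    ContinuousLinearMap.id_apply, mul_left_comm]

/-- An operator which is carried by isometries into another one has at most its norm. -/
theorem opNorm_le_of_intertwining {A A' B B' : Type*} [NormedAddCommGroup A] [InnerProductSpace ℂ A]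
    [NormedAddCommGroup A'] [InnerProductSpace ℂ A'] [NormedAddCommGroup B] [InnerProductSpace ℂ B]
    [NormedAddCommGroup B'] [InnerProductSpace ℂ B'] {X : A →L[ℂ] B} {X' : A' →L[ℂ] B'}
    (S : A →ₗᵢ[ℂ] A') (T : B →ₗᵢ[ℂ] B') (h : ∀ x, T (X x) = X' (S x)) : ‖X‖ ≤ ‖X'‖ :=
  ContinuousLinearMap.opNorm_le_bound _ (norm_nonneg _) fun x => by
    rw [← T.norm_map, h, ← S.norm_map x]
    exact X'.le_opNorm _

/-- An intertwining relation between linear maps from an amplification into operators may be checked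
on elementary tensors. -/
theorem intertwining_of_tmul {A A' B B' : Type*} [NormedAddCommGroup A] [NormedSpace ℂ A]
    [NormedAddCommGroup A'] [NormedSpace ℂ A'] [NormedAddCommGroup B] [NormedSpace ℂ B]
    [NormedAddCommGroup B'] [NormedSpace ℂ B'] (f : Amp L E →ₗ[ℂ] (A →L[ℂ] B))
    (g : Amp L E →ₗ[ℂ] (A' →L[ℂ] B')) (S : A →L[ℂ] A') (T : B →L[ℂ] B')
    (h : ∀ a x, T ∘L f (a ⊗ₜ x) = g (a ⊗ₜ x) ∘L S) (u : Amp L E) : T ∘L f u = g u ∘L S := by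
  induction u using TensorProduct.induction_on with
  | zero => simp
  | add u v hu hv =>
    rw [map_add, map_add, ContinuousLinearMap.comp_add, ContinuousLinearMap.add_comp, hu, hv]
  | tmul a x => exact h a x

/-- A multiplicativity relation for the Effros symbol may be checked on elementary tensors. -/
theorem map_effros_of_tmul {A B C : Type*} [NormedAddCommGroup A] [NormedSpace ℂ A]
    [NormedAddCommGroup B] [NormedSpace ℂ B] [NormedAddCommGroup C] [NormedSpace ℂ C]
    (f : Amp L E →ₗ[ℂ] (B →L[ℂ] C)) (g : Amp L F →ₗ[ℂ] (A →L[ℂ] B))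
    (k : Amp L (E ⊗[ℂ] F) →ₗ[ℂ] (A →L[ℂ] C))
    (h : ∀ a x b y, k (effros L E F (a ⊗ₜ x) (b ⊗ₜ y)) = f (a ⊗ₜ x) ∘L g (b ⊗ₜ y))
    (u : Amp L E) (v : Amp L F) : k (effros L E F u v) = f u ∘L g v := by
  induction u using TensorProduct.induction_on with
  | zero => simp
  | add u u' hu hu' => rw [LinearMap.map_add₂, map_add, map_add, hu, hu',
      ContinuousLinearMap.add_comp]
  | tmul a x =>
    induction v using TensorProduct.induction_on with
    | zero => simp
    | add v v' hv hv' => rw [map_add, map_add, map_add, hv, hv', ContinuousLinearMap.comp_add]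
    | tmul b y => exact h a x b y

variable (M) in
/-- The map `x ↦ I x ⊗ 1` into operators, for a map `I` into operators. -/
def opTensorId {P : Type*} [AddCommMonoid P] [Module ℂ P]
    (I : P →ₗ[ℂ] (H₁ →L[ℂ] K₁)) : P →ₗ[ℂ] (HTensor H₁ M →L[ℂ] HTensor K₁ M) :=
  opTensorₗ.flip (.id ℂ M) ∘ₗ I

theorem opTensorId_apply {P : Type*} [AddCommMonoid P] [Module ℂ P]
    (I : P →ₗ[ℂ] (H₁ →L[ℂ] K₁)) (x : P) :
    opTensorId M I x = opTensor (I x) (.id ℂ M) := rfl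

variable (M) in
/-- The map `y ↦ 1 ⊗ J y` into operators, for a map `J` into operators. -/
def idOpTensor {P : Type*} [AddCommMonoid P] [Module ℂ P]
    (J : P →ₗ[ℂ] (H₂ →L[ℂ] K₂)) : P →ₗ[ℂ] (HTensor M H₂ →L[ℂ] HTensor M K₂) :=
  opTensorₗ (.id ℂ M) ∘ₗ J

theorem idOpTensor_apply {P : Type*} [AddCommMonoid P] [Module ℂ P]
    (J : P →ₗ[ℂ] (H₂ →L[ℂ] K₂)) (y : P) :
    idOpTensor M J y = opTensor (.id ℂ M) (J y) := rfl

variable (M) in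
/-- Tensoring the operators of an operator space on the right with the identity of a Hilbert space
does not increase the concrete norm. -/
theorem norm_ampOp_opTensor_id_le (I : E →ₗ[ℂ] (H₁ →L[ℂ] K₁)) (u : Amp L E) :
    ‖ampOp L (opTensorId M I) u‖ ≤ ‖ampOp L I u‖ := by
  obtain ⟨S, hS⟩ := exists_assoc_isometry L H₁ M
  obtain ⟨T, hT⟩ := exists_assoc_isometry L K₁ M
  have key := intertwining_of_tmul (ampOp L (opTensorId M I)) (opTensorId M (ampOp L I))
    S.toContinuousLinearMap T.toContinuousLinearMap (fun a x => hom_ext fun ℓ z => ?_) u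
  · exact (opNorm_le_of_intertwining S T fun x => congrArg (fun f => f x) key).trans
      (norm_opTensor_id_le (ampOp L I u))
  rw [ContinuousLinearMap.comp_apply, ContinuousLinearMap.comp_apply,
    LinearIsometry.coe_toContinuousLinearMap, LinearIsometry.coe_toContinuousLinearMap,
    ampOp_tmul, opTensor_htmul, hS, hT, opTensorId_apply, opTensorId_apply, ampOp_tmul,
    opTensor_comp_apply, opTensor_comp_apply]
  congr 2
  ext h
  rw [ContinuousLinearMap.comp_apply, ContinuousLinearMap.comp_apply, htmulLeft_apply,
    htmulLeft_apply, opTensor_htmul]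

variable (M) in
/-- Tensoring the operators of an operator space on the left with the identity of a Hilbert space
does not increase the concrete norm. -/
theorem norm_ampOp_id_opTensor_le (J : F →ₗ[ℂ] (H₂ →L[ℂ] K₂)) (v : Amp L F) :
    ‖ampOp L (idOpTensor M J) v‖ ≤ ‖ampOp L J v‖ := by
  obtain ⟨S, hS⟩ := exists_leftComm_isometry L M H₂
  obtain ⟨T, hT⟩ := exists_leftComm_isometry L M K₂
  have key := intertwining_of_tmul (ampOp L (idOpTensor M J)) (idOpTensor M (ampOp L J))
    S.toContinuousLinearMap T.toContinuousLinearMap (fun a x => hom_ext fun ℓ z => ?_) v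
  · exact (opNorm_le_of_intertwining S T fun x => congrArg (fun f => f x) key).trans
      (norm_id_opTensor_le (ampOp L J v))
  rw [ContinuousLinearMap.comp_apply, ContinuousLinearMap.comp_apply,
    LinearIsometry.coe_toContinuousLinearMap, LinearIsometry.coe_toContinuousLinearMap,
    ampOp_tmul, opTensor_htmul, hS, hT, idOpTensor_apply, idOpTensor_apply, ampOp_tmul,
    opTensor_comp_apply, opTensor_comp_apply]
  congr 2
  ext h
  rw [ContinuousLinearMap.comp_apply, ContinuousLinearMap.comp_apply, htmulLeft_apply,
    htmulLeft_apply, opTensor_htmul]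

/-- `a b ⊗ (I x ⊗ J y) = (a ⊗ (I x ⊗ 1)) (b ⊗ (1 ⊗ J y))`, extended bilinearly. -/
theorem ampOp_spatialEmb_effros (I : E →ₗ[ℂ] (H₁ →L[ℂ] K₁)) (J : F →ₗ[ℂ] (H₂ →L[ℂ] K₂))
    (u : Amp L E) (v : Amp L F) :
    ampOp L (spatialEmb I J) (effros L E F u v) =
      ampOp L (opTensorId K₂ I) u ∘L ampOp L (idOpTensor H₁ J) v := by
  refine map_effros_of_tmul (ampOp L (opTensorId K₂ I)) (ampOp L (idOpTensor H₁ J)) _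
    (fun a x b y => ?_) u v
  rw [effros_tmul_tmul, ampOp_tmul, ampOp_tmul, ampOp_tmul, coe_cptMul, spatialEmb_tmul,
    opTensorId_apply, idOpTensor_apply, ← opTensor_comp, ← opTensor_comp]
  rfl

/-- The Effros symbol is contractive for the spatial norm. -/
theorem spatialNorm_effros_le (I : E →ₗ[ℂ] (H₁ →L[ℂ] K₁)) (J : F →ₗ[ℂ] (H₂ →L[ℂ] K₂))
    (u : Amp L E) (v : Amp L F) :
    spatialNorm L I J (effros L E F u v) ≤ concreteNorm L I u * concreteNorm L J v := by
  rw [spatialNorm, concreteNorm, ampOp_spatialEmb_effros]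
  exact (ContinuousLinearMap.opNorm_comp_le _ _).trans
    (mul_le_mul (norm_ampOp_opTensor_id_le K₂ I u) (norm_ampOp_id_opTensor_le H₁ J v)
      (norm_nonneg (ampOp L (idOpTensor H₁ J) v)) (concreteNorm_nonneg I u))

/-- The Haagerup norm of concrete quantum norms is the spatial norm as soon as every element has
factorizations into a single Effros symbol whose cost is arbitrarily close to the spatial norm. -/
theorem haagerupNorm_eq_spatialNorm (I : E →ₗ[ℂ] (H₁ →L[ℂ] K₁)) (J : F →ₗ[ℂ] (H₂ →L[ℂ] K₂))
    {U : Amp L (E ⊗[ℂ] F)}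
    (h : ∀ ε > 0, ∃ (u : Amp L E) (v : Amp L F), U = effros L E F u v ∧
      concreteNorm L I u * concreteNorm L J v ≤ spatialNorm L I J U + ε) :
    haagerupNorm (concreteNorm L I) (concreteNorm L J) U = spatialNorm L I J U := by
  have mem : ∀ u v, U = effros L E F u v → concreteNorm L I u * concreteNorm L J v ∈
      {r : ℝ | ∃ (n : ℕ) (u : Fin n → Amp L E) (v : Fin n → Amp L F),
        U = ∑ k, effros L E F (u k) (v k) ∧
          r = ∑ k, concreteNorm L I (u k) * concreteNorm L J (v k)} := fun u v hU =>
    ⟨1, fun _ => u, fun _ => v, by simpa using hU, by simp⟩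
  apply le_antisymm
  · refine le_of_forall_pos_le_add fun ε hε => ?_
    obtain ⟨u, v, hU, hle⟩ := h ε hε
    refine (csInf_le ⟨0, ?_⟩ (mem u v hU)).trans hle
    rintro r ⟨n, u, v, -, rfl⟩
    exact Finset.sum_nonneg fun k _ =>
      mul_nonneg (concreteNorm_nonneg I _) (concreteNorm_nonneg J _)
  · obtain ⟨u, v, hU, -⟩ := h 1 one_pos
    refine le_csInf ⟨_, mem u v hU⟩ ?_
    rintro r ⟨n, u, v, hU, rfl⟩
    rw [hU]
    exact (concreteNorm_sum_le _ _ _).trans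
      (Finset.sum_le_sum fun k _ => spatialNorm_effros_le I J _ _)

end Multiplicativity

/-! ### Common factors of compact operators -/

section Factorization

/-- The weighted sum `∑ 2⁻⁽ⁿ⁺¹⁾ pₙ` of a sequence of elements of an algebra. -/
def weightedSum {R : Type*} [NormedRing R] [NormedAlgebra ℂ R] (p : ℕ → R) : R :=
  ∑' n, ((2 : ℂ)⁻¹ ^ (n + 1)) • p n

/-- The element `a + ∑ 2ⁿ (a - pₙ a)`, which the weighted sum of an increasing sequence of
projections multiplies to `a`. -/
def weightedLift {R : Type*} [NormedRing R] [NormedAlgebra ℂ R] (p : ℕ → R) (a : R) : R :=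
  a + ∑' n, ((2 : ℂ) ^ n) • (a - p n * a)

variable {R : Type*} [NormedRing R] [NormedAlgebra ℂ R] {p : ℕ → R} {a : R} {δ : ℝ}

theorem norm_weightedSum_term_le (hp1 : ∀ n, ‖p n‖ ≤ 1) (n : ℕ) :
    ‖((2 : ℂ)⁻¹ ^ (n + 1)) • p n‖ ≤ 1 / 2 / 2 ^ n := by
  rw [norm_smul, norm_pow, norm_inv, Complex.norm_ofNat]
  calc (2⁻¹ : ℝ) ^ (n + 1) * ‖p n‖ ≤ (2⁻¹ : ℝ) ^ (n + 1) * 1 := by gcongr; exact hp1 n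
    _ = _ := by rw [pow_succ, inv_pow]; ring

theorem norm_weightedLift_term_le (ha : ∀ n, ‖a - p n * a‖ ≤ δ / 2 / 4 ^ n) (n : ℕ) :
    ‖((2 : ℂ) ^ n) • (a - p n * a)‖ ≤ δ / 2 / 2 ^ n := by
  rw [norm_smul, norm_pow, Complex.norm_ofNat]
  calc (2 : ℝ) ^ n * ‖a - p n * a‖ ≤ 2 ^ n * (δ / 2 / 4 ^ n) := by gcongr; exact ha n
    _ = _ := by
      rw [show (4 : ℝ) = 2 * 2 by norm_num, mul_pow]
      field_simp

theorem norm_weightedSum_le (hp1 : ∀ n, ‖p n‖ ≤ 1) : ‖weightedSum p‖ ≤ 1 :=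
  tsum_of_norm_bounded (hasSum_geometric_two' 1) (norm_weightedSum_term_le hp1)

theorem norm_weightedLift_sub_le (ha : ∀ n, ‖a - p n * a‖ ≤ δ / 2 / 4 ^ n) :
    ‖weightedLift p a - a‖ ≤ δ := by
  rw [weightedLift, add_sub_cancel_left]
  exact tsum_of_norm_bounded (hasSum_geometric_two' δ) (norm_weightedLift_term_le ha)

variable [CompleteSpace R]

theorem summable_weightedSum (hp1 : ∀ n, ‖p n‖ ≤ 1) :
    Summable fun n => ((2 : ℂ)⁻¹ ^ (n + 1)) • p n :=
  .of_norm_bounded (summable_geometric_two' 1) (norm_weightedSum_term_le hp1)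

theorem summable_weightedLift (ha : ∀ n, ‖a - p n * a‖ ≤ δ / 2 / 4 ^ n) :
    Summable fun n => ((2 : ℂ) ^ n) • (a - p n * a) :=
  .of_norm_bounded (summable_geometric_two' δ) (norm_weightedLift_term_le ha)

/-- If `pₙ` increases and `pₙ a → a` fast, then `a = (∑ 2⁻⁽ⁿ⁺¹⁾ pₙ) (a + ∑ 2ⁿ (a - pₙ a))`: on
the range of `pₙ - pₙ₋₁` the two factors act as `2⁻ⁿ` and `2ⁿ`. -/
theorem weightedSum_mul_weightedLift (hp1 : ∀ n, ‖p n‖ ≤ 1)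
    (hp : ∀ m n, p m * p n = p (min m n)) (ha : ∀ n, ‖a - p n * a‖ ≤ δ / 2 / 4 ^ n) :
    weightedSum p * weightedLift p a = a := by
  set r : ℕ → R := fun m => ∑ n ∈ Finset.range m, ((2 : ℂ) ^ n) • (p n * a) with hr
  have hpc : ∀ m, p m * weightedLift p a = ((2 : ℂ) ^ m) • (p m * a) - r m := by
    intro m
    -- the terms with `n ≥ m` are killed by `p m`, as `p m * p n = p m`
    have h0 : ∀ n ∉ Finset.range m, p m * (((2 : ℂ) ^ n) • (a - p n * a)) = 0 := by
      intro n hn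
      rw [Finset.mem_range, not_lt] at hn
      rw [mul_smul_comm, mul_sub, ← mul_assoc, hp, min_eq_left hn, sub_self, smul_zero]
    have hgeom : ∀ k : ℕ, ∑ n ∈ Finset.range k, (2 : ℂ) ^ n = 2 ^ k - 1 := fun k => by
      rw [geom_sum_eq (by norm_num)]; norm_num
    rw [weightedLift, mul_add, ← (summable_weightedLift ha).tsum_mul_left, tsum_eq_sum h0]
    have h1 : ∀ n ∈ Finset.range m, p m * (((2 : ℂ) ^ n) • (a - p n * a)) =
        ((2 : ℂ) ^ n) • (p m * a) - ((2 : ℂ) ^ n) • (p n * a) := by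
      intro n hn
      rw [mul_smul_comm, mul_sub, ← mul_assoc, hp, min_eq_right (Finset.mem_range.1 hn).le,
        smul_sub]
    rw [Finset.sum_congr rfl h1, Finset.sum_sub_distrib, ← Finset.sum_smul, hgeom, sub_smul,
      one_smul]
    abel
  have hpart : ∀ N, ∑ n ∈ Finset.range N, (((2 : ℂ)⁻¹ ^ (n + 1)) • p n) * weightedLift p a =
      ((2 : ℂ)⁻¹ ^ N) • r N := by
    intro N
    induction N with
    | zero => simp [hr]
    | succ N ih =>
      have h2 : (2 : ℂ)⁻¹ ^ N = (2 : ℂ)⁻¹ ^ (N + 1) + (2 : ℂ)⁻¹ ^ (N + 1) := by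
        rw [pow_succ]; ring
      have : r (N + 1) = r N + ((2 : ℂ) ^ N) • (p N * a) := by
        simp only [hr, Finset.sum_range_succ]
      rw [Finset.sum_range_succ, ih, smul_mul_assoc, hpc, this, smul_sub, smul_add]
      nth_rewrite 1 [h2]
      rw [add_smul]
      abel
  have hlim1 := ((summable_weightedSum hp1).hasSum.mul_right (weightedLift p a)).tendsto_sum_nat
  -- the partial sums `2⁻ᴺ ∑_{n < N} 2ⁿ pₙ a` are averages which converge to `a`
  have hlim2 : Filter.Tendsto (fun N => ((2 : ℂ)⁻¹ ^ N) • r N) Filter.atTop (nhds a) := by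
    have hz : Filter.Tendsto (fun N : ℕ => ((2 : ℂ)⁻¹ ^ N) •
        (a + ∑ n ∈ Finset.range N, ((2 : ℂ) ^ n) • (a - p n * a))) Filter.atTop
        (nhds ((0 : ℂ) • weightedLift p a)) := by
      refine (tendsto_pow_atTop_nhds_zero_of_norm_lt_one ?_).smul
        (tendsto_const_nhds.add (summable_weightedLift ha).hasSum.tendsto_sum_nat)
      rw [norm_inv, Complex.norm_ofNat]; norm_num
    have hz' := tendsto_const_nhds (x := a) |>.sub hz
    rw [zero_smul, sub_zero] at hz'
    refine hz'.congr fun N => ?_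
    have hgeom : ∑ n ∈ Finset.range N, (2 : ℂ) ^ n = 2 ^ N - 1 := by
      rw [geom_sum_eq (by norm_num)]; norm_num
    simp only [smul_sub, Finset.sum_sub_distrib, ← Finset.sum_smul, hgeom, sub_smul, one_smul]
    rw [show a + ((2 : ℂ) ^ N • a - a - r N) = (2 : ℂ) ^ N • a - r N by abel, smul_sub, smul_smul,
      ← mul_pow, inv_mul_cancel₀ two_ne_zero, one_pow, one_smul, sub_sub_cancel]
  exact tendsto_nhds_unique (hlim1.congr hpart) hlim2

end Factorization

section Compact

variable {L : Type*} [NormedAddCommGroup L] [InnerProductSpace ℂ L]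

/-- A compact operator is uniformly almost unchanged by the projections onto the subspaces which
contain a suitable finite set. -/
theorem exists_finset_norm_sub_starProjection_le (a : Cpt L) {δ : ℝ} (hδ : 0 < δ) :
    ∃ t : Finset L, ∀ (W : Submodule ℂ L) [W.HasOrthogonalProjection], (t : Set L) ⊆ W →
      ‖(a : L →L[ℂ] L) - W.starProjection * a‖ ≤ δ := by
  have hc : IsCompact (closure ((a : L →L[ℂ] L) '' Metric.closedBall 0 1)) :=
    IsCompactOperator.isCompact_closure_image_closedBall (f := (a : L →L[ℂ] L).toLinearMap) a.2 1
  obtain ⟨t, htf, ht⟩ := Metric.totallyBounded_iff.1 hc.totallyBounded δ hδ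
  refine ⟨htf.toFinset, fun W _ hW => ContinuousLinearMap.opNorm_le_of_unit_norm hδ.le
    fun x hx => ?_⟩
  have hmem := ht (subset_closure ⟨x, by simp [hx], rfl⟩)
  simp only [Set.mem_iUnion, Metric.mem_ball, exists_prop] at hmem
  obtain ⟨y, hy, hxy⟩ := hmem
  have hyW : y ∈ W := hW (by simpa using hy)
  rw [dist_eq_norm] at hxy
  have hmin := Submodule.starProjection_minimal (U := W) ((a : L →L[ℂ] L) x)
  calc ‖((a : L →L[ℂ] L) - W.starProjection * a) x‖
      = ‖(a : L →L[ℂ] L) x - W.starProjection ((a : L →L[ℂ] L) x)‖ := rfl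
    _ = ⨅ w : W, ‖(a : L →L[ℂ] L) x - w‖ := hmin
    _ ≤ ‖(a : L →L[ℂ] L) x - (⟨y, hyW⟩ : W)‖ :=
        ciInf_le ⟨0, by rintro _ ⟨w, rfl⟩; exact norm_nonneg _⟩ _
    _ ≤ δ := hxy.le

theorem isCompactOperator_of_finiteDimensional (W : Submodule ℂ L) [FiniteDimensional ℂ W] :
    IsCompactOperator W.starProjection := by
  have : ProperSpace W := FiniteDimensional.proper ℂ W
  exact IsCompactOperator.clm_comp (f := W.orthogonalProjectionOnto)
    (isCompactOperator_of_locallyCompactSpace_dom W.orthogonalProjectionOnto) W.subtypeL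

variable [CompleteSpace L]

/-- The adjoint of a compact operator is compact, as a limit of the finite-rank operators `a⋆ p`. -/
theorem adjoint_mem_cpt (a : Cpt L) : (a : L →L[ℂ] L).adjoint ∈ Cpt L := by
  have hclosed : IsClosed ((Cpt L : Submodule ℂ (L →L[ℂ] L)) : Set (L →L[ℂ] L)) :=
    isClosed_setOfPred_isCompactOperator
  refine hclosed.closure_subset (Metric.mem_closure_iff.2 fun ε hε => ?_)
  obtain ⟨t, ht⟩ := exists_finset_norm_sub_starProjection_le a (half_pos hε)
  have : FiniteDimensional ℂ (Submodule.span ℂ (t : Set L)) := FiniteDimensional.span_finset ℂ t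
  set p := (Submodule.span ℂ (t : Set L)).starProjection with hp
  refine ⟨(a : L →L[ℂ] L).adjoint ∘L p,
    (isCompactOperator_of_finiteDimensional _).clm_comp (a : L →L[ℂ] L).adjoint, ?_⟩
  have hpa : p.adjoint = p := isSelfAdjoint_starProjection _
  have h : (a : L →L[ℂ] L).adjoint - (a : L →L[ℂ] L).adjoint ∘L p =
      ((a : L →L[ℂ] L) - p * (a : L →L[ℂ] L)).adjoint := by
    rw [map_sub, ContinuousLinearMap.mul_def, ContinuousLinearMap.adjoint_comp, hpa]
  rw [dist_eq_norm, h, LinearIsometryEquiv.norm_map]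
  exact (ht _ Submodule.subset_span).trans_lt (half_lt_self hε)

/-- Finitely many compact operators have, with an arbitrarily small perturbation of one of the
factors, a common compact left factor of norm at most one. -/
theorem exists_common_left_factor (A : Finset (Cpt L)) {δ : ℝ} (hδ : 0 < δ) :
    ∃ (b : Cpt L) (f : Cpt L → Cpt L), ‖(b : L →L[ℂ] L)‖ ≤ 1 ∧
      ∀ a ∈ A, cptMulLeft (b : L →L[ℂ] L) (f a) = a ∧ ‖f a - a‖ ≤ δ := by
  classical
  choose t ht using fun (n : ℕ) (a : Cpt L) =>
    exists_finset_norm_sub_starProjection_le a (δ := δ / 2 / 4 ^ n) (by positivity)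
  -- the sets are accumulated over `m ≤ n`, so that the subspaces increase
  let V : ℕ → Submodule ℂ L := fun n =>
    Submodule.span ℂ (((Finset.range (n + 1)).biUnion fun m => A.biUnion (t m) : Finset L) : Set L)
  have hVfin : ∀ n, FiniteDimensional ℂ (V n) := fun n => FiniteDimensional.span_finset ℂ _
  have hVmono : Monotone V := fun m n hmn => Submodule.span_mono (Finset.coe_subset.2
    (Finset.biUnion_subset_biUnion_of_subset_left _ (Finset.range_mono (by omega))))
  let p : ℕ → (L →L[ℂ] L) := fun n => (V n).starProjection
  have hp1 : ∀ n, ‖p n‖ ≤ 1 := fun n => Submodule.starProjection_norm_le _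
  have hpp : ∀ m n, p m * p n = p (min m n) := by
    intro m n
    rcases le_total m n with h | h
    · rw [min_eq_left h]
      exact Submodule.starProjection_comp_starProjection_of_le (hVmono h)
    · rw [min_eq_right h]
      ext x
      exact Submodule.starProjection_eq_self_iff.2
        (hVmono h (Submodule.starProjection_apply_mem (V n) x))
  have hpa : ∀ a ∈ A, ∀ n, ‖(a : L →L[ℂ] L) - p n * a‖ ≤ δ / 2 / 4 ^ n := fun a ha n =>
    ht n a (V n) fun x hx => Submodule.subset_span (Finset.mem_coe.2 (Finset.mem_biUnion.2
      ⟨n, Finset.self_mem_range_succ n, Finset.mem_biUnion.2 ⟨a, ha, hx⟩⟩))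
  have hclosed : IsClosed ((Cpt L : Submodule ℂ (L →L[ℂ] L)) : Set (L →L[ℂ] L)) :=
    isClosed_setOfPred_isCompactOperator
  have hpc : ∀ n, p n ∈ Cpt L := fun n => isCompactOperator_of_finiteDimensional (V n)
  have hb : weightedSum p ∈ Cpt L := by
    refine hclosed.mem_of_tendsto (summable_weightedSum hp1).hasSum.tendsto_sum_nat
      (Filter.Eventually.of_forall fun N => ?_)
    exact Submodule.sum_mem _ fun n _ => Submodule.smul_mem _ _ (hpc n)
  have hc : ∀ a ∈ A, weightedLift p (a : L →L[ℂ] L) ∈ Cpt L := by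
    intro a ha
    refine Submodule.add_mem _ a.2 (hclosed.mem_of_tendsto
      (summable_weightedLift (hpa a ha)).hasSum.tendsto_sum_nat
      (Filter.Eventually.of_forall fun N => ?_))
    exact Submodule.sum_mem _ fun n _ => Submodule.smul_mem _ _
      (Submodule.sub_mem _ a.2 (IsCompactOperator.clm_comp a.2 (p n)))
  refine ⟨⟨weightedSum p, hb⟩, fun a => if h : a ∈ A then ⟨_, hc a h⟩ else a,
    norm_weightedSum_le hp1, fun a ha => ?_⟩
  beta_reduce
  rw [dif_pos ha]
  exact ⟨Subtype.ext (weightedSum_mul_weightedLift hp1 hpp (hpa a ha)),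
    norm_weightedLift_sub_le (hpa a ha)⟩

/-- Finitely many compact operators have, with an arbitrarily small perturbation of one of the
factors, a common compact right factor of norm at most one. -/
theorem exists_common_right_factor (A : Finset (Cpt L)) {δ : ℝ} (hδ : 0 < δ) :
    ∃ (b : Cpt L) (f : Cpt L → Cpt L), ‖(b : L →L[ℂ] L)‖ ≤ 1 ∧
      ∀ a ∈ A, cptMulRight (b : L →L[ℂ] L) (f a) = a ∧ ‖f a - a‖ ≤ δ := by
  classical
  let adj : Cpt L → Cpt L := fun a => ⟨_, adjoint_mem_cpt a⟩
  obtain ⟨b, f, hb, hf⟩ := exists_common_left_factor (A.image adj) hδ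
  refine ⟨adj b, fun a => adj (f (adj a)), ?_, fun a ha => ?_⟩
  · exact (LinearIsometryEquiv.norm_map ContinuousLinearMap.adjoint (b : L →L[ℂ] L)).trans_le hb
  obtain ⟨h1, h2⟩ := hf (adj a) (Finset.mem_image_of_mem _ ha)
  constructor
  · have := congrArg (fun c : Cpt L => (c : L →L[ℂ] L).adjoint) h1
    refine Subtype.ext ?_
    simpa [cptMulLeft, cptMulRight, adj, ContinuousLinearMap.adjoint_comp] using this
  · have h3 : ‖((f (adj a) - adj a : Cpt L) : L →L[ℂ] L).adjoint‖ ≤ δ :=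
      (LinearIsometryEquiv.norm_map ContinuousLinearMap.adjoint _).trans_le h2
    simpa [adj] using h3

end Compact

/-! ### Isometries with orthogonal ranges -/

section OrthogonalIsometries

variable {ι A A' B B' C D : Type*}
  [NormedAddCommGroup A] [InnerProductSpace ℂ A] [NormedAddCommGroup A'] [InnerProductSpace ℂ A']
  [NormedAddCommGroup B] [InnerProductSpace ℂ B] [NormedAddCommGroup B'] [InnerProductSpace ℂ B']
  [NormedAddCommGroup C] [InnerProductSpace ℂ C] [NormedAddCommGroup D] [InnerProductSpace ℂ D]

/-- A family of isometries with pairwise orthogonal ranges, that is, `Jᵢ⋆ Jⱼ = δᵢⱼ`. -/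
def OrthogonalIsometries [DecidableEq ι] (J : ι → A →L[ℂ] B) : Prop :=
  ∀ i j x y, inner ℂ (J i x) (J j y) = if i = j then inner ℂ x y else 0

variable [DecidableEq ι]

theorem OrthogonalIsometries.adjoint_comp [CompleteSpace A] [CompleteSpace B]
    {J : ι → A →L[ℂ] B} (hJ : OrthogonalIsometries J) (i j : ι) :
    (J i).adjoint ∘L J j = if i = j then .id ℂ A else 0 := by
  ext x
  refine ext_inner_left ℂ fun y => ?_
  rw [ContinuousLinearMap.comp_apply, ContinuousLinearMap.adjoint_inner_right, hJ]
  split_ifs <;> simp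

theorem OrthogonalIsometries.norm_sum_sq [Fintype ι] {J : ι → A →L[ℂ] B}
    (hJ : OrthogonalIsometries J) (x : ι → A) : ‖∑ i, J i (x i)‖ ^ 2 = ∑ i, ‖x i‖ ^ 2 := by
  have : ((‖∑ i, J i (x i)‖ : ℂ)) ^ 2 = ∑ i, (‖x i‖ : ℂ) ^ 2 := by
    simp only [← inner_self_eq_norm_sq_to_K (𝕜 := ℂ), ← Complex.coe_algebraMap]
    simp only [sum_inner, inner_sum, hJ _ _ _ _, Finset.mem_univ, if_true, Finset.sum_ite_eq']
  exact_mod_cast this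

theorem OrthogonalIsometries.norm_apply {J : ι → A →L[ℂ] B}
    (hJ : OrthogonalIsometries J) (i : ι) (x : A) : ‖J i x‖ = ‖x‖ := by
  rw [@norm_eq_sqrt_re_inner ℂ, hJ, if_pos rfl, ← norm_eq_sqrt_re_inner]

theorem OrthogonalIsometries.norm_le_one {J : ι → A →L[ℂ] B} (hJ : OrthogonalIsometries J) (i : ι) :
    ‖J i‖ ≤ 1 :=
  ContinuousLinearMap.opNorm_le_bound _ zero_le_one fun x => by rw [hJ.norm_apply, one_mul]

/-- If `Jᵢ` and `Tᵢ` are isometries with pairwise orthogonal ranges, then `∑ Jᵢ Tᵢ⋆` is a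
contraction, by Bessel's inequality. -/
theorem OrthogonalIsometries.norm_sum_comp_adjoint_le [Fintype ι] [CompleteSpace A]
    [CompleteSpace C] {J : ι → A →L[ℂ] B} {T : ι → A →L[ℂ] C} (hJ : OrthogonalIsometries J)
    (hT : OrthogonalIsometries T) : ‖∑ i, J i ∘L (T i).adjoint‖ ≤ 1 := by
  refine ContinuousLinearMap.opNorm_le_bound _ zero_le_one fun x => ?_
  rw [one_mul]
  have h1 : ‖(∑ i, J i ∘L (T i).adjoint) x‖ ^ 2 = ∑ i, ‖(T i).adjoint x‖ ^ 2 := by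
    rw [← hJ.norm_sum_sq, sum_apply]; rfl
  have h2 : ∑ i, ‖(T i).adjoint x‖ ^ 2 = ‖∑ i, T i ((T i).adjoint x)‖ ^ 2 :=
    (hT.norm_sum_sq _).symm
  have h3 : ∑ i, ‖(T i).adjoint x‖ ^ 2 = RCLike.re (inner ℂ x (∑ i, T i ((T i).adjoint x))) := by
    rw [inner_sum, map_sum]
    refine Finset.sum_congr rfl fun i _ => ?_
    rw [← ContinuousLinearMap.adjoint_inner_left, inner_self_eq_norm_sq]
  have h4 := re_inner_le_norm (𝕜 := ℂ) x (∑ i, T i ((T i).adjoint x))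
  have h5 : ‖∑ i, T i ((T i).adjoint x)‖ ≤ ‖x‖ := by
    by_contra! h
    nlinarith [norm_nonneg x]
  rw [h2] at h1
  exact le_of_sq_le_sq (by nlinarith [norm_nonneg (∑ i, T i ((T i).adjoint x))]) (norm_nonneg x)

/-- The norm of a column `∑ Jᵢ Vᵢ` does not depend on the family `J` of isometries with orthogonal
ranges. -/
theorem OrthogonalIsometries.norm_sum_comp_le [Fintype ι] {J : ι → B →L[ℂ] C} {T : ι → B →L[ℂ] B'}
    (hJ : OrthogonalIsometries J) (hT : OrthogonalIsometries T) (V : ι → A →L[ℂ] B)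
    (X : A' →L[ℂ] C) (Θ : A →L[ℂ] A') (hΘ : ∀ x, ‖Θ x‖ ≤ ‖x‖)
    (h : X ∘L Θ = ∑ i, J i ∘L V i) : ‖∑ i, T i ∘L V i‖ ≤ ‖X‖ := by
  refine ContinuousLinearMap.opNorm_le_bound _ (norm_nonneg _) fun x => ?_
  have h1 : ‖(∑ i, T i ∘L V i) x‖ ^ 2 = ∑ i, ‖V i x‖ ^ 2 := by
    rw [← hT.norm_sum_sq, sum_apply]; rfl
  have h2 : ‖X (Θ x)‖ ^ 2 = ∑ i, ‖V i x‖ ^ 2 := by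
    rw [← hJ.norm_sum_sq, ← ContinuousLinearMap.comp_apply, h, sum_apply]; rfl
  rw [(sq_eq_sq₀ (norm_nonneg _) (norm_nonneg _)).1 (h1.trans h2.symm)]
  exact (X.le_opNorm _).trans (by gcongr; exact hΘ x)

/-- The norm of a row `∑ Vᵢ Tᵢ⋆` is at most that of any operator which restricts to the `Vᵢ` along
isometries with orthogonal ranges. -/
theorem OrthogonalIsometries.norm_sum_comp_adjoint_le_of_comp_eq [Fintype ι] [CompleteSpace A]
    [CompleteSpace A'] {J : ι → A →L[ℂ] C} {T : ι → A →L[ℂ] A'}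
    (hJ : OrthogonalIsometries J) (hT : OrthogonalIsometries T) (V : ι → A →L[ℂ] B)
    (X : C →L[ℂ] D) (Θ : B →L[ℂ] D) (hΘ : ∀ x, ‖Θ x‖ = ‖x‖)
    (h : ∀ i, X ∘L J i = Θ ∘L V i) : ‖∑ i, V i ∘L (T i).adjoint‖ ≤ ‖X‖ := by
  have key : Θ ∘L (∑ i, V i ∘L (T i).adjoint) = X ∘L ∑ i, J i ∘L (T i).adjoint := by
    simp only [ContinuousLinearMap.comp_finsetSum, ← ContinuousLinearMap.comp_assoc, h]
  refine ContinuousLinearMap.opNorm_le_bound _ (norm_nonneg _) fun x => ?_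
  rw [← hΘ, ← ContinuousLinearMap.comp_apply, key]
  refine (ContinuousLinearMap.le_opNorm _ _).trans ?_
  gcongr
  exact (ContinuousLinearMap.opNorm_comp_le _ _).trans
    (mul_le_of_le_one_right (norm_nonneg _) (hJ.norm_sum_comp_adjoint_le hT))

theorem OrthogonalIsometries.opTensor_id {J : ι → A →L[ℂ] B} (hJ : OrthogonalIsometries J) :
    OrthogonalIsometries fun i => opTensor (J i) (.id ℂ D) := by
  intro i j z w
  rw [inner_opTensor_opTensor (c := if i = j then 1 else 0)]
  · split_ifs <;> simp
  · intro x y x' y'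
    rw [hJ]
    split_ifs <;> simp

theorem OrthogonalIsometries.id_opTensor {J : ι → A →L[ℂ] B} (hJ : OrthogonalIsometries J) :
    OrthogonalIsometries fun i => opTensor (.id ℂ D) (J i) := by
  intro i j z w
  rw [inner_opTensor_opTensor (c := if i = j then 1 else 0)]
  · split_ifs <;> simp
  · intro x y x' y'
    rw [hJ]
    split_ifs <;> simp

variable {e : ι → A}

theorem orthogonalIsometries_columnEmb (he : Orthonormal ℂ e) :
    OrthogonalIsometries fun i => columnEmb A (e i) := by
  intro i j x y
  have := orthonormal_iff_ite.1 he i j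
  simp only [columnEmb, LinearMap.coe_mk, AddHom.coe_mk, ContinuousLinearMap.toSpanSingleton_apply,
    inner_smul_left, inner_smul_right, this]
  split_ifs <;> simp [mul_comm]

theorem orthogonalIsometries_htmulLeft (he : Orthonormal ℂ e) :
    OrthogonalIsometries fun i => (htmulLeft (e i) : B →L[ℂ] HTensor A B) := by
  intro i j x y
  rw [htmulLeft_apply, htmulLeft_apply, inner_htmul, orthonormal_iff_ite.1 he i j]
  split_ifs <;> simp

theorem orthogonalIsometries_htmulRight (he : Orthonormal ℂ e) :
    OrthogonalIsometries fun i => (htmulRight (e i) : B →L[ℂ] HTensor B A) := by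
  intro i j x y
  rw [htmulRight_apply, htmulRight_apply, inner_htmul, orthonormal_iff_ite.1 he i j]
  split_ifs <;> simp

theorem orthonormal_conjSpace (he : Orthonormal ℂ e) :
    Orthonormal ℂ fun i => ConjSpace.toOrig.symm (e i) := by
  rw [orthonormal_iff_ite] at he ⊢
  intro i j
  exact (he j i).trans (by simp only [eq_comm])

theorem adjoint_columnEmb_conjSpace [CompleteSpace A] (x : A) :
    (columnEmb (ConjSpace A) (ConjSpace.toOrig.symm x)).adjoint = rowEmb A x := by
  ext y
  refine ext_inner_left ℂ fun c => ?_
  rw [ContinuousLinearMap.adjoint_inner_right]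
  have h1 : columnEmb (ConjSpace A) (ConjSpace.toOrig.symm x) c = c • ConjSpace.toOrig.symm x := rfl
  have h2 : rowEmb A x y = inner ℂ (ConjSpace.toOrig y) x := rfl
  have h3 : inner ℂ (ConjSpace.toOrig.symm x) y = inner ℂ (ConjSpace.toOrig y) x := rfl
  rw [h1, h2, inner_smul_left, h3]
  simp [mul_comm]

/-- An infinite-dimensional Hilbert space contains arbitrarily many orthogonal copies of itself. -/
theorem exists_orthogonalIsometries [CompleteSpace A] (hA : ¬ FiniteDimensional ℂ A) (n : ℕ) :
    ∃ S : Fin n → A →L[ℂ] A, OrthogonalIsometries S := by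
  obtain ⟨w, b, -⟩ := exists_hilbertBasis ℂ A
  have hw : Infinite w := by
    by_contra hfin
    rw [not_infinite_iff_finite] at hfin
    have := Fintype.ofFinite w
    exact hA (Module.Basis.finiteDimensional_of_finite b.toOrthonormalBasis.toBasis)
  -- `n` disjoint copies of the index set of a Hilbert basis embed into the index set
  obtain ⟨f⟩ : Nonempty ((Fin n × w) ↪ w) := by
    rw [← Cardinal.le_def]
    simp only [Cardinal.mk_prod, Cardinal.mk_fin, Cardinal.lift_natCast, Cardinal.lift_uzero]
    refine (Cardinal.mul_le_max_of_aleph0_le_right (Cardinal.aleph0_le_mk w)).trans ?_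
    exact max_le ((Cardinal.natCast_lt_aleph0.le).trans (Cardinal.aleph0_le_mk w)) le_rfl
  have hv : ∀ i, Orthonormal ℂ fun m => b (f (i, m)) := fun i =>
    b.orthonormal.comp _ fun m m' h => by simpa using h
  let T : Fin n → A →ₗᵢ[ℂ] A := fun i =>
    (hv i).orthogonalFamily.linearIsometry.comp b.repr.toLinearIsometry
  have hsum : ∀ i x, HasSum (fun m => (b.repr x m) • b (f (i, m))) (T i x) := fun i x => by
    have h := (hv i).orthogonalFamily.hasSum_linearIsometry (b.repr x)
    simp only [LinearIsometry.toSpanSingleton_apply] at h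
    exact h
  refine ⟨fun i => (T i).toContinuousLinearMap, fun i j x y => ?_⟩
  split_ifs with hij
  · subst hij
    exact (T i).inner_map_map x y
  · have hb : ∀ m m', inner ℂ (b (f (i, m))) (b (f (j, m'))) = 0 := fun m m' =>
      b.orthonormal.2 fun h => hij (congrArg Prod.fst (f.injective h))
    have h1 : ∀ m, inner ℂ (b (f (i, m))) (T j y) = 0 := fun m =>
      ((hsum j y).mapL (innerSL ℂ (b (f (i, m))))).unique (by
        simp [hb])
    have h2 := (hsum i x).mapL (innerSL ℂ (T j y))
    have h3 : inner ℂ (T j y) (T i x) = 0 := h2.unique (by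
      have : ∀ m, inner ℂ (T j y) (b (f (i, m))) = 0 := fun m => inner_eq_zero_symm.1 (h1 m)
      simp [this])
    exact inner_eq_zero_symm.1 h3

end OrthogonalIsometries

/-! ### Amplifications: factorizations and orthonormal expansions -/

section Amplification

variable {L : Type*} [NormedAddCommGroup L] [InnerProductSpace ℂ L]
variable {E F : Type*} [AddCommGroup E] [Module ℂ E] [AddCommGroup F] [Module ℂ F]
variable {H H₁ K₁ : Type*} [NormedAddCommGroup H] [InnerProductSpace ℂ H]
  [NormedAddCommGroup H₁] [InnerProductSpace ℂ H₁] [NormedAddCommGroup K₁] [InnerProductSpace ℂ K₁]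

theorem ampMap_tmul (φ : E →ₗ[ℂ] F) (a : Cpt L) (x : E) : ampMap L φ (a ⊗ₜ x) = a ⊗ₜ φ x := rfl

theorem leftAct_leftAct (a b : L →L[ℂ] L) (u : Amp L E) :
    leftAct a (leftAct b u) = leftAct (a ∘L b) u := by
  have : leftAct a ∘ₗ leftAct b = leftAct (E := E) (a ∘L b) := TensorProduct.ext' fun _ _ => rfl
  exact LinearMap.congr_fun this u

theorem rightAct_rightAct (a b : L →L[ℂ] L) (u : Amp L E) :
    rightAct a (rightAct b u) = rightAct (b ∘L a) u := by
  have : rightAct a ∘ₗ rightAct b = rightAct (E := E) (b ∘L a) := TensorProduct.ext' fun _ _ => rfl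
  exact LinearMap.congr_fun this u

theorem leftAct_zero (u : Amp L E) : leftAct 0 u = 0 := by
  have : leftAct (0 : L →L[ℂ] L) = (0 : Amp L E →ₗ[ℂ] Amp L E) := TensorProduct.ext' fun a x => by
    have : cptMulLeft (0 : L →L[ℂ] L) a = 0 := Subtype.ext (by simp [cptMulLeft])
    rw [leftAct, LinearMap.rTensor_tmul, this, TensorProduct.zero_tmul]; rfl
  exact LinearMap.congr_fun this u

theorem rightAct_zero (u : Amp L E) : rightAct 0 u = 0 := by
  have : rightAct (0 : L →L[ℂ] L) = (0 : Amp L E →ₗ[ℂ] Amp L E) := TensorProduct.ext' fun a x => by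
    have : cptMulRight (0 : L →L[ℂ] L) a = 0 := Subtype.ext (by simp [cptMulRight])
    rw [rightAct, LinearMap.rTensor_tmul, this, TensorProduct.zero_tmul]; rfl
  exact LinearMap.congr_fun this u

theorem effros_tmul_left (a : Cpt L) (x : E) (v : Amp L F) :
    effros L E F (a ⊗ₜ x) v =
      ampMap L (TensorProduct.mk ℂ E F x) (leftAct (a : L →L[ℂ] L) v) := by
  have : effros L E F (a ⊗ₜ x) = ampMap L (TensorProduct.mk ℂ E F x) ∘ₗ leftAct (a : L →L[ℂ] L) :=
    TensorProduct.ext' fun _ _ => rfl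
  exact LinearMap.congr_fun this v

theorem effros_tmul_right (u : Amp L E) (b : Cpt L) (y : F) :
    effros L E F u (b ⊗ₜ y) =
      ampMap L ((TensorProduct.mk ℂ E F).flip y) (rightAct (b : L →L[ℂ] L) u) := by
  have : (effros L E F).flip (b ⊗ₜ y) =
      ampMap L ((TensorProduct.mk ℂ E F).flip y) ∘ₗ rightAct (b : L →L[ℂ] L) :=
    TensorProduct.ext' fun _ _ => rfl
  exact LinearMap.congr_fun this u

/-- Every element of `𝒦 ⊗ (H ⊗ E)` involves only finitely many orthonormal vectors of `H`. -/
theorem exists_orthonormal_eq_sum_ampMap_mk (U : Amp L (H ⊗[ℂ] E)) :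
    ∃ (n : ℕ) (e : Fin n → H) (w : Fin n → Amp L E), Orthonormal ℂ e ∧
      U = ∑ i, ampMap L (TensorProduct.mk ℂ H E (e i)) (w i) := by
  obtain ⟨V, hV, hU⟩ := TensorProduct.exists_finite_submodule_left_of_setFinite
    {TensorProduct.leftComm ℂ (Cpt L) H E U} (Set.finite_singleton _)
  obtain ⟨z, hz⟩ := hU (Set.mem_singleton _)
  let b := stdOrthonormalBasis ℂ V
  have hsum : ∀ z : V ⊗[ℂ] Amp L E, ∃ w : Fin _ → Amp L E, z = ∑ i, b i ⊗ₜ[ℂ] w i := by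
    intro z
    induction z using TensorProduct.induction_on with
    | zero => exact ⟨0, by simp⟩
    | add z z' hz hz' =>
      obtain ⟨w, rfl⟩ := hz
      obtain ⟨w', rfl⟩ := hz'
      exact ⟨w + w', by simp [TensorProduct.tmul_add, Finset.sum_add_distrib]⟩
    | tmul x u =>
      refine ⟨fun i => b.repr x i • u, ?_⟩
      conv_lhs => rw [← b.sum_repr x, TensorProduct.sum_tmul]
      simp [TensorProduct.smul_tmul]
  obtain ⟨w, rfl⟩ := hsum z
  refine ⟨_, fun i => (b i : H), w, b.orthonormal.comp_linearIsometry V.subtypeₗᵢ, ?_⟩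
  apply (TensorProduct.leftComm ℂ (Cpt L) H E).injective
  refine hz.symm.trans ?_
  rw [map_sum]
  refine Eq.trans ?_ (map_sum (TensorProduct.leftComm ℂ (Cpt L) H E).toLinearMap _ _).symm
  refine Finset.sum_congr rfl fun i _ => ?_
  have : (TensorProduct.leftComm ℂ (Cpt L) H E).toLinearMap ∘ₗ
      ampMap L (TensorProduct.mk ℂ H E (b i : H)) = TensorProduct.mk ℂ H (Amp L E) (b i : H) :=
    TensorProduct.ext' fun _ _ => rfl
  exact (LinearMap.congr_fun this (w i)).symm

/-- Every element of `𝒦 ⊗ (E ⊗ H)` involves only finitely many orthonormal vectors of `H`. -/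
theorem exists_orthonormal_eq_sum_ampMap_mk_flip (U : Amp L (E ⊗[ℂ] H)) :
    ∃ (n : ℕ) (e : Fin n → H) (w : Fin n → Amp L E), Orthonormal ℂ e ∧
      U = ∑ i, ampMap L ((TensorProduct.mk ℂ E H).flip (e i)) (w i) := by
  obtain ⟨n, e, w, he, hU⟩ := exists_orthonormal_eq_sum_ampMap_mk
    (ampMap L (TensorProduct.comm ℂ E H).toLinearMap U)
  refine ⟨n, e, w, he, ?_⟩
  have h1 : ampMap L (TensorProduct.comm ℂ H E).toLinearMap ∘ₗ
      ampMap L (TensorProduct.comm ℂ E H).toLinearMap = LinearMap.id := by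
    refine TensorProduct.ext' fun a x => ?_
    simp [ampMap_tmul]
  have h2 : ∀ i, ampMap L (TensorProduct.comm ℂ H E).toLinearMap ∘ₗ
      ampMap L (TensorProduct.mk ℂ H E (e i)) = ampMap L ((TensorProduct.mk ℂ E H).flip (e i)) :=
    fun i => TensorProduct.ext' fun _ _ => rfl
  have h3 := congrArg (ampMap L (TensorProduct.comm ℂ H E).toLinearMap) hU
  rw [← LinearMap.comp_apply, h1, LinearMap.id_apply, map_sum] at h3
  rw [h3]
  exact Finset.sum_congr rfl fun i _ => LinearMap.congr_fun (h2 i) (w i)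

/-- If a linear map `m` sends small perturbations of suitable compact operators `a` back to `a`,
then `m ⊗ 1` sends small perturbations of finitely many given elements of an amplification back to
them. -/
theorem exists_perturbation {ι : Type*} [Fintype ι] (I : E →ₗ[ℂ] (H₁ →L[ℂ] K₁)) (w : ι → Amp L E)
    {ε : ℝ} (hε : 0 < ε) : ∃ (A : Finset (Cpt L)) (δ : ℝ), 0 < δ ∧
      ∀ (m : Cpt L →ₗ[ℂ] Cpt L) (f : Cpt L → Cpt L), (∀ a ∈ A, m (f a) = a ∧ ‖f a - a‖ ≤ δ) →
        ∃ r : ι → Amp L E, (∀ i, m.rTensor E (w i + r i) = w i) ∧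
          ∀ i, concreteNorm L I (r i) ≤ ε := by
  classical
  choose S hS using fun i => TensorProduct.exists_finset (w i)
  set c : ι → ℝ := fun i => ∑ p ∈ S i, ‖I p.2‖ with hc
  have hc0 : ∀ i, 0 ≤ c i := fun i => Finset.sum_nonneg fun p _ => norm_nonneg _
  have hC0 : 0 ≤ ∑ i, c i := Finset.sum_nonneg fun i _ => hc0 i
  refine ⟨Finset.univ.biUnion fun i => (S i).image Prod.fst, ε / (∑ i, c i + 1), by positivity,
    fun m f hf => ⟨fun i => ∑ p ∈ S i, (f p.1 - p.1) ⊗ₜ p.2, fun i => ?_, fun i => ?_⟩⟩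
  · have hsum : w i + ∑ p ∈ S i, (f p.1 - p.1) ⊗ₜ[ℂ] p.2 = ∑ p ∈ S i, f p.1 ⊗ₜ[ℂ] p.2 := by
      rw [hS i, ← Finset.sum_add_distrib]
      exact Finset.sum_congr rfl fun p _ => by rw [← TensorProduct.add_tmul, add_sub_cancel]
    rw [hsum, map_sum, hS i]
    refine Finset.sum_congr rfl fun p hp => ?_
    rw [LinearMap.rTensor_tmul, (hf p.1 (Finset.mem_biUnion.2 ⟨i, Finset.mem_univ i,
      Finset.mem_image_of_mem _ hp⟩)).1]
  · have hi : c i ≤ ∑ i, c i := Finset.single_le_sum (fun i _ => hc0 i) (Finset.mem_univ i)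
    calc concreteNorm L I (∑ p ∈ S i, (f p.1 - p.1) ⊗ₜ[ℂ] p.2)
        ≤ ∑ p ∈ S i, concreteNorm L I ((f p.1 - p.1) ⊗ₜ[ℂ] p.2) := concreteNorm_sum_le _ _ _
      _ ≤ ∑ p ∈ S i, ε / (∑ i, c i + 1) * ‖I p.2‖ := by
          refine Finset.sum_le_sum fun p hp => ?_
          refine (concreteNorm_tmul_le I _ _).trans ?_
          gcongr
          exact (hf p.1 (Finset.mem_biUnion.2 ⟨i, Finset.mem_univ i,
            Finset.mem_image_of_mem _ hp⟩)).2
      _ = ε / (∑ i, c i + 1) * c i := by rw [Finset.mul_sum]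
      _ ≤ ε / (∑ i, c i + 1) * (∑ i, c i + 1) := by gcongr; linarith
      _ = ε := div_mul_cancel₀ _ (by positivity)

variable [CompleteSpace L]

/-- Finitely many elements of an amplification have a common compact left factor of norm at most
one, the other factors being small perturbations of the elements. -/
theorem exists_leftAct_factorization {ι : Type*} [Fintype ι] (I : E →ₗ[ℂ] (H₁ →L[ℂ] K₁))
    (w : ι → Amp L E) {ε : ℝ} (hε : 0 < ε) :
    ∃ (b : Cpt L) (r : ι → Amp L E), ‖(b : L →L[ℂ] L)‖ ≤ 1 ∧
      (∀ i, leftAct (b : L →L[ℂ] L) (w i + r i) = w i) ∧ ∀ i, concreteNorm L I (r i) ≤ ε := by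
  obtain ⟨A, δ, hδ, hA⟩ := exists_perturbation I w hε
  obtain ⟨b, f, hb, hf⟩ := exists_common_left_factor A hδ
  obtain ⟨r, h1, h2⟩ := hA _ f hf
  exact ⟨b, r, hb, h1, h2⟩

/-- Finitely many elements of an amplification have a common compact right factor of norm at most
one, the other factors being small perturbations of the elements. -/
theorem exists_rightAct_factorization {ι : Type*} [Fintype ι] (I : E →ₗ[ℂ] (H₁ →L[ℂ] K₁))
    (w : ι → Amp L E) {ε : ℝ} (hε : 0 < ε) :
    ∃ (b : Cpt L) (r : ι → Amp L E), ‖(b : L →L[ℂ] L)‖ ≤ 1 ∧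
      (∀ i, rightAct (b : L →L[ℂ] L) (w i + r i) = w i) ∧ ∀ i, concreteNorm L I (r i) ≤ ε := by
  obtain ⟨A, δ, hδ, hA⟩ := exists_perturbation I w hε
  obtain ⟨b, f, hb, hf⟩ := exists_common_right_factor A hδ
  obtain ⟨r, h1, h2⟩ := hA _ f hf
  exact ⟨b, r, hb, h1, h2⟩

end Amplification

/-! ### Column and row spaces -/

section ColumnRow

variable {L : Type*} [NormedAddCommGroup L] [InnerProductSpace ℂ L]
variable {E : Type*} [AddCommGroup E] [Module ℂ E]
variable {H H₁ K₁ : Type*} [NormedAddCommGroup H] [InnerProductSpace ℂ H]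
  [NormedAddCommGroup H₁] [InnerProductSpace ℂ H₁] [NormedAddCommGroup K₁] [InnerProductSpace ℂ K₁]

theorem norm_id_opTensor_apply {A B : Type*} [NormedAddCommGroup A] [InnerProductSpace ℂ A]
    [NormedAddCommGroup B] [InnerProductSpace ℂ B] (b : A →L[ℂ] B) (hb : ∀ x, ‖b x‖ = ‖x‖)
    (z : HTensor L A) : ‖opTensor (.id ℂ L) b z‖ = ‖z‖ := by
  have h : OrthogonalIsometries fun _ : Unit => b := fun _ _ _ _ => by
    rw [if_pos rfl]
    exact (⟨b.toLinearMap, hb⟩ : A →ₗᵢ[ℂ] B).inner_map_map _ _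
  exact (h.id_opTensor (D := L)).norm_apply () z

theorem columnEmb_injective : Function.Injective (columnEmb H) := fun _ _ h => by
  have := congrArg (fun T : ℂ →L[ℂ] H => T 1) h
  simpa [columnEmb] using this

theorem rowEmb_injective : Function.Injective (rowEmb H) := fun _ _ h =>
  ext_inner_left ℂ fun z => congrArg (fun T : ConjSpace H →L[ℂ] ℂ => T (ConjSpace.toOrig.symm z)) h

/-- The operator of `x ⊗ w` in the spatial tensor product of a column space and an operator space is
the operator of `w` followed by `k ↦ x ⊗ k`. -/
theorem ampOp_column_comp (I : E →ₗ[ℂ] (H₁ →L[ℂ] K₁)) (x : H) (w : Amp L E) :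
    opTensor (.id ℂ L) (htmulLeft x) ∘L ampOp L I w =
      ampOp L (spatialEmb (columnEmb H) I) (ampMap L (TensorProduct.mk ℂ H E x) w) ∘L
        opTensor (.id ℂ L) (htmulLeft (1 : ℂ)) := by
  refine intertwining_of_tmul (ampOp L I)
    (ampOp L (spatialEmb (columnEmb H) I) ∘ₗ ampMap L (TensorProduct.mk ℂ H E x)) _ _
    (fun a y => ?_) w
  rw [LinearMap.comp_apply, ampMap_tmul, ampOp_tmul, ampOp_tmul, TensorProduct.mk_apply,
    spatialEmb_tmul, ← opTensor_comp, ← opTensor_comp]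
  congr 1
  ext h
  rw [ContinuousLinearMap.comp_apply, ContinuousLinearMap.comp_apply, htmulLeft_apply,
    htmulLeft_apply, opTensor_htmul]
  simp [columnEmb]

/-- The operator of `w ⊗ y` in the spatial tensor product of an operator space and a row space,
restricted to the copy `h ↦ h ⊗ z` of the domain of the operator space, is the operator of `w`
up to the scalar `⟪y, z⟫`. -/
theorem ampOp_row_comp (I : E →ₗ[ℂ] (H₁ →L[ℂ] K₁)) (y : H) (z : ConjSpace H) (w : Amp L E) :
    opTensor (.id ℂ L) (htmulRight (rowEmb H y z)) ∘L ampOp L I w =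
      ampOp L (spatialEmb I (rowEmb H)) (ampMap L ((TensorProduct.mk ℂ E H).flip y) w) ∘L
        opTensor (.id ℂ L) (htmulRight z) := by
  refine intertwining_of_tmul (ampOp L I)
    (ampOp L (spatialEmb I (rowEmb H)) ∘ₗ ampMap L ((TensorProduct.mk ℂ E H).flip y)) _ _
    (fun a x => ?_) w
  rw [LinearMap.comp_apply, ampMap_tmul, ampOp_tmul, ampOp_tmul, LinearMap.flip_apply,
    TensorProduct.mk_apply, spatialEmb_tmul, ← opTensor_comp, ← opTensor_comp]
  congr 1
  ext h
  rw [ContinuousLinearMap.comp_apply, ContinuousLinearMap.comp_apply, htmulRight_apply,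
    htmulRight_apply, opTensor_htmul]

variable {ι : Type*} [Fintype ι] [DecidableEq ι] {e : ι → H} {S : ι → L →L[ℂ] L}

/-- Stacking the `wᵢ` with orthogonal isometries of `L` costs no more than stacking them with
orthonormal vectors of the column space. -/
theorem concreteNorm_sum_leftAct_le (I : E →ₗ[ℂ] (H₁ →L[ℂ] K₁)) (he : Orthonormal ℂ e)
    (hS : OrthogonalIsometries S) (w : ι → Amp L E) :
    concreteNorm L I (∑ i, leftAct (S i) (w i)) ≤ spatialNorm L (columnEmb H) I
      (∑ i, ampMap L (TensorProduct.mk ℂ H E (e i)) (w i)) := by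
  rw [concreteNorm, spatialNorm, concreteNorm, map_sum, map_sum]
  simp only [ampOp_leftAct]
  refine OrthogonalIsometries.norm_sum_comp_le
    (orthogonalIsometries_htmulLeft (B := K₁) he).id_opTensor hS.opTensor_id
    (fun i => ampOp L I (w i)) _ (opTensor (.id ℂ L) (htmulLeft (1 : ℂ)))
    (fun z => (norm_id_opTensor_apply _ (fun h => ?_) z).le) ?_
  · rw [htmulLeft_apply, norm_htmul, norm_one, one_mul]
  · rw [ContinuousLinearMap.finsetSum_comp]
    exact Finset.sum_congr rfl fun i _ => (ampOp_column_comp I (e i) (w i)).symm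

variable [CompleteSpace L]

/-- Lining up the `wᵢ` with coisometries of `L` costs no more than lining them up with orthonormal
vectors of the row space. -/
theorem concreteNorm_sum_rightAct_le (I : E →ₗ[ℂ] (H₁ →L[ℂ] K₁)) [CompleteSpace H₁]
    (he : Orthonormal ℂ e) (hS : OrthogonalIsometries S) (w : ι → Amp L E) :
    concreteNorm L I (∑ i, rightAct (S i).adjoint (w i)) ≤ spatialNorm L I (rowEmb H)
      (∑ i, ampMap L ((TensorProduct.mk ℂ E H).flip (e i)) (w i)) := by
  have hadj : ∀ i, opTensor (S i).adjoint (.id ℂ H₁) = (opTensor (S i) (.id ℂ H₁)).adjoint :=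
    fun i => by rw [adjoint_opTensor, ContinuousLinearMap.adjoint_id]
  rw [concreteNorm, spatialNorm, concreteNorm, map_sum, map_sum]
  simp only [ampOp_rightAct, hadj]
  refine OrthogonalIsometries.norm_sum_comp_adjoint_le_of_comp_eq
    (orthogonalIsometries_htmulRight (B := H₁) (orthonormal_conjSpace he)).id_opTensor
    hS.opTensor_id (fun i => ampOp L I (w i)) _ (opTensor (.id ℂ L) (htmulRight (1 : ℂ)))
    (fun z => norm_id_opTensor_apply _ (fun h => ?_) z) fun i => ?_
  · rw [htmulRight_apply, norm_htmul, norm_one, mul_one]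
  · rw [ContinuousLinearMap.finsetSum_comp, Finset.sum_eq_single i]
    · rw [← ampOp_row_comp]
      have : rowEmb H (e i) (ConjSpace.toOrig.symm (e i)) = 1 :=
        (orthonormal_iff_ite.1 he i i).trans (if_pos rfl)
      rw [this]
    · intro j _ hj
      rw [← ampOp_row_comp]
      have : rowEmb H (e j) (ConjSpace.toOrig.symm (e i)) = 0 := he.2 hj.symm
      rw [this, show (htmulRight (0 : ℂ) : K₁ →L[ℂ] HTensor K₁ ℂ) = 0 by ext; simp [htmulRight],
        opTensor_zero_right, ContinuousLinearMap.zero_comp]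
    · exact fun h => absurd (Finset.mem_univ i) h

theorem columnNorm_sum_le_one (b : Cpt L) (hb : ‖(b : L →L[ℂ] L)‖ ≤ 1) (he : Orthonormal ℂ e)
    (hS : OrthogonalIsometries S) :
    concreteNorm L (columnEmb H) (∑ i, cptMulRight (S i).adjoint b ⊗ₜ e i) ≤ 1 := by
  have hterm : ∀ i, ampOp L (columnEmb H) (cptMulRight (S i).adjoint b ⊗ₜ e i) =
      opTensor (b : L →L[ℂ] L) (.id ℂ H) ∘L
        (opTensor (.id ℂ L) (columnEmb H (e i)) ∘L (opTensor (S i) (.id ℂ ℂ)).adjoint) :=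
      fun i => by
    rw [adjoint_opTensor, ContinuousLinearMap.adjoint_id, ← opTensor_comp, ← opTensor_comp]
    rfl
  rw [concreteNorm, map_sum, Finset.sum_congr rfl fun i _ => hterm i,
    ← ContinuousLinearMap.comp_finsetSum]
  refine (ContinuousLinearMap.opNorm_comp_le _ _).trans
    (mul_le_one₀ ((norm_opTensor_id_le _).trans hb) (norm_nonneg _) ?_)
  exact (orthogonalIsometries_columnEmb he).id_opTensor.norm_sum_comp_adjoint_le hS.opTensor_id

theorem rowNorm_sum_le_one [CompleteSpace H] (b : Cpt L) (hb : ‖(b : L →L[ℂ] L)‖ ≤ 1)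
    (he : Orthonormal ℂ e) (hS : OrthogonalIsometries S) :
    concreteNorm L (rowEmb H) (∑ i, cptMulLeft (S i) b ⊗ₜ e i) ≤ 1 := by
  have hterm : ∀ i, ampOp L (rowEmb H) (cptMulLeft (S i) b ⊗ₜ e i) =
      (opTensor (S i) (.id ℂ ℂ) ∘L (opTensor (.id ℂ L)
        (columnEmb (ConjSpace H) (ConjSpace.toOrig.symm (e i)))).adjoint) ∘L
        opTensor (b : L →L[ℂ] L) (.id ℂ (ConjSpace H)) := fun i => by
    rw [adjoint_opTensor, ContinuousLinearMap.adjoint_id, adjoint_columnEmb_conjSpace,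
      ← opTensor_comp, ← opTensor_comp]
    rfl
  rw [concreteNorm, map_sum, Finset.sum_congr rfl fun i _ => hterm i,
    ← ContinuousLinearMap.finsetSum_comp]
  refine (ContinuousLinearMap.opNorm_comp_le _ _).trans
    (mul_le_one₀ ?_ (norm_nonneg _) ((norm_opTensor_id_le _).trans hb))
  exact hS.opTensor_id.norm_sum_comp_adjoint_le
    (orthogonalIsometries_columnEmb (orthonormal_conjSpace he)).id_opTensor

/-- On `H_c ⊗ E` the Haagerup norm is the spatial norm. Every `U = ∑ eᵢ ⊗ wᵢ` with orthonormal `eᵢ`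
and `wᵢ = b (wᵢ + rᵢ)` is `(∑ b Sᵢ⋆ ⊗ eᵢ) ⊙ (∑ Sᵢ (wᵢ + rᵢ))`. -/
theorem haagerupNorm_column (hL : ¬ FiniteDimensional ℂ L) (I : E →ₗ[ℂ] (H₁ →L[ℂ] K₁))
    (U : Amp L (H ⊗[ℂ] E)) :
    haagerupNorm (concreteNorm L (columnEmb H)) (concreteNorm L I) U =
      spatialNorm L (columnEmb H) I U := by
  refine haagerupNorm_eq_spatialNorm _ _ fun ε hε => ?_
  obtain ⟨n, e, w, he, rfl⟩ := exists_orthonormal_eq_sum_ampMap_mk U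
  obtain ⟨S, hS⟩ := exists_orthogonalIsometries hL n
  obtain ⟨b, r, hb, hw, hclose⟩ := exists_leftAct_factorization I w
    (ε := ε / (n + 1)) (by positivity)
  refine ⟨∑ i, cptMulRight (S i).adjoint b ⊗ₜ e i, ∑ i, leftAct (S i) (w i + r i), ?_, ?_⟩
  · rw [map_sum (effros L H E), LinearMap.sum_apply]
    refine Finset.sum_congr rfl fun i _ => ?_
    rw [effros_tmul_left]
    congr 1
    have hb' : ∀ j, leftAct ((cptMulRight (S i).adjoint b : Cpt L) : L →L[ℂ] L)
        (leftAct (S j) (w j + r j)) = if i = j then w j else 0 := fun j => by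
      rw [leftAct_leftAct, show ((cptMulRight (S i).adjoint b : Cpt L) : L →L[ℂ] L) ∘L S j =
        (b : L →L[ℂ] L) ∘L ((S i).adjoint ∘L S j) from rfl, hS.adjoint_comp]
      split_ifs
      · rw [ContinuousLinearMap.comp_id, hw]
      · rw [ContinuousLinearMap.comp_zero, leftAct_zero]
    rw [map_sum, Finset.sum_congr rfl fun j _ => hb' j, Finset.sum_ite_eq,
      if_pos (Finset.mem_univ i)]
  · have hv : concreteNorm L I (∑ i, leftAct (S i) (w i + r i)) ≤ spatialNorm L (columnEmb H) I
        (∑ i, ampMap L (TensorProduct.mk ℂ H E (e i)) (w i)) + ε := by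
      have hsplit : ∑ i, leftAct (S i) (w i + r i) =
          ∑ i, leftAct (S i) (w i) + ∑ i, leftAct (S i) (r i) := by
        rw [← Finset.sum_add_distrib]
        exact Finset.sum_congr rfl fun i _ => map_add _ _ _
      rw [hsplit]
      refine (concreteNorm_add_le _ _ _).trans
        (add_le_add (concreteNorm_sum_leftAct_le I he hS w) ?_)
      calc concreteNorm L I (∑ i, leftAct (S i) (r i))
          ≤ ∑ i, concreteNorm L I (leftAct (S i) (r i)) := concreteNorm_sum_le _ _ _
        _ ≤ ∑ _i : Fin n, ε / (n + 1) := Finset.sum_le_sum fun i _ =>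
            (concreteNorm_leftAct_le I _ _).trans ((mul_le_of_le_one_left
              (concreteNorm_nonneg I _) (hS.norm_le_one i)).trans (hclose i))
        _ = n * (ε / (n + 1)) := by simp
        _ ≤ (n + 1) * (ε / (n + 1)) := by gcongr; linarith
        _ = ε := mul_div_cancel₀ _ (by positivity)
    exact (mul_le_of_le_one_left (concreteNorm_nonneg I _)
      (columnNorm_sum_le_one b hb he hS)).trans hv

/-- On `E ⊗ H_r` the Haagerup norm is the spatial norm. Every `U = ∑ wᵢ ⊗ eᵢ` with orthonormal `eᵢ`
and `wᵢ = (wᵢ + rᵢ) b` is `(∑ (wᵢ + rᵢ) Sᵢ⋆) ⊙ (∑ Sᵢ b ⊗ eᵢ)`. -/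
theorem haagerupNorm_row [CompleteSpace H] [CompleteSpace H₁] (hL : ¬ FiniteDimensional ℂ L)
    (I : E →ₗ[ℂ] (H₁ →L[ℂ] K₁)) (U : Amp L (E ⊗[ℂ] H)) :
    haagerupNorm (concreteNorm L I) (concreteNorm L (rowEmb H)) U =
      spatialNorm L I (rowEmb H) U := by
  refine haagerupNorm_eq_spatialNorm _ _ fun ε hε => ?_
  obtain ⟨n, e, w, he, rfl⟩ := exists_orthonormal_eq_sum_ampMap_mk_flip U
  obtain ⟨S, hS⟩ := exists_orthogonalIsometries hL n
  obtain ⟨b, r, hb, hw, hclose⟩ := exists_rightAct_factorization I w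
    (ε := ε / (n + 1)) (by positivity)
  refine ⟨∑ i, rightAct (S i).adjoint (w i + r i), ∑ i, cptMulLeft (S i) b ⊗ₜ e i, ?_, ?_⟩
  · rw [map_sum]
    refine Finset.sum_congr rfl fun i _ => ?_
    rw [effros_tmul_right]
    congr 1
    have hb' : ∀ j, rightAct ((cptMulLeft (S i) b : Cpt L) : L →L[ℂ] L)
        (rightAct (S j).adjoint (w j + r j)) = if j = i then w j else 0 := fun j => by
      rw [rightAct_rightAct, show (S j).adjoint ∘L ((cptMulLeft (S i) b : Cpt L) : L →L[ℂ] L) =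
        ((S j).adjoint ∘L S i) ∘L (b : L →L[ℂ] L) from rfl, hS.adjoint_comp]
      split_ifs
      · rw [ContinuousLinearMap.id_comp, hw]
      · rw [ContinuousLinearMap.zero_comp, rightAct_zero]
    rw [map_sum, Finset.sum_congr rfl fun j _ => hb' j, Finset.sum_ite_eq',
      if_pos (Finset.mem_univ i)]
  · have hv : concreteNorm L I (∑ i, rightAct (S i).adjoint (w i + r i)) ≤
        spatialNorm L I (rowEmb H)
          (∑ i, ampMap L ((TensorProduct.mk ℂ E H).flip (e i)) (w i)) + ε := by
      have hsplit : ∑ i, rightAct (S i).adjoint (w i + r i) =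
          ∑ i, rightAct (S i).adjoint (w i) + ∑ i, rightAct (S i).adjoint (r i) := by
        rw [← Finset.sum_add_distrib]
        exact Finset.sum_congr rfl fun i _ => map_add _ _ _
      have hS1 : ∀ i, ‖(S i).adjoint‖ ≤ 1 := fun i =>
        (LinearIsometryEquiv.norm_map ContinuousLinearMap.adjoint (S i)).trans_le
          (hS.norm_le_one i)
      rw [hsplit]
      refine (concreteNorm_add_le _ _ _).trans
        (add_le_add (concreteNorm_sum_rightAct_le I he hS w) ?_)
      calc concreteNorm L I (∑ i, rightAct (S i).adjoint (r i))
          ≤ ∑ i, concreteNorm L I (rightAct (S i).adjoint (r i)) :=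
            concreteNorm_sum_le _ _ _
        _ ≤ ∑ _i : Fin n, ε / (n + 1) := Finset.sum_le_sum fun i _ =>
            (concreteNorm_rightAct_le I _ _).trans ((mul_le_of_le_one_left
              (concreteNorm_nonneg I _) (hS1 i)).trans (hclose i))
        _ = n * (ε / (n + 1)) := by simp
        _ ≤ (n + 1) * (ε / (n + 1)) := by gcongr; linarith
        _ = ε := mul_div_cancel₀ _ (by positivity)
    exact (mul_le_of_le_one_right (concreteNorm_nonneg I _)
      (rowNorm_sum_le_one b hb he hS)).trans hv

/-- If the Haagerup norm agrees with the spatial norm, then the identity map between the two tensor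
products is a completely isometric isomorphism of quantum spaces. -/
theorem isCompletelyIsometricIso_id {F H₂ K₂ : Type*} [AddCommGroup F] [Module ℂ F]
    [NormedAddCommGroup H₂] [InnerProductSpace ℂ H₂] [NormedAddCommGroup K₂]
    [InnerProductSpace ℂ K₂] {I : E →ₗ[ℂ] (H₁ →L[ℂ] K₁)} {J : F →ₗ[ℂ] (H₂ →L[ℂ] K₂)}
    (hI : Function.Injective I) (hJ : Function.Injective J) {N : Amp L (E ⊗[ℂ] F) → ℝ}
    (h : ∀ U, N U = spatialNorm L I J U) :
    IsCompletelyIsometricIso N (spatialNorm L I J) (LinearMap.id : E ⊗[ℂ] F →ₗ[ℂ] E ⊗[ℂ] F) := by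
  have hq : IsQuantumNorm (spatialNorm L I J) :=
    isQuantumNorm_concreteNorm (spatialEmb_injective hI hJ)
  have hid : ampMap L (LinearMap.id : E ⊗[ℂ] F →ₗ[ℂ] E ⊗[ℂ] F) = LinearMap.id :=
    LinearMap.lTensor_id _ _
  obtain rfl : N = spatialNorm L I J := funext h
  refine ⟨hq, hq, ?_, fun U => ?_⟩
  · rw [hid]; exact Function.bijective_id
  · rw [hid]; rfl

end ColumnRow

end QuantumSpaces

end

theorem proposition26
    (L : Type*) [NormedAddCommGroup L] [InnerProductSpace ℂ L] [CompleteSpace L]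
    [TopologicalSpace.SeparableSpace L] (hL : ¬ FiniteDimensional ℂ L)
    (H : Type*) [NormedAddCommGroup H] [InnerProductSpace ℂ H] [CompleteSpace H]
    (H₁ : Type*) [NormedAddCommGroup H₁] [InnerProductSpace ℂ H₁] [CompleteSpace H₁]
    (K₁ : Type*) [NormedAddCommGroup K₁] [InnerProductSpace ℂ K₁] [CompleteSpace K₁]
    (E : Submodule ℂ (H₁ →L[ℂ] K₁)) :
    QuantumSpaces.IsCompletelyIsometricIso
        (QuantumSpaces.haagerupNorm
          (QuantumSpaces.columnNorm L H) (QuantumSpaces.standardNorm L E))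
        (QuantumSpaces.spatialNorm L (QuantumSpaces.columnEmb H) E.subtype)
        (LinearMap.id : H ⊗[ℂ] E →ₗ[ℂ] H ⊗[ℂ] E) ∧
      QuantumSpaces.IsCompletelyIsometricIso
        (QuantumSpaces.haagerupNorm
          (QuantumSpaces.standardNorm L E) (QuantumSpaces.rowNorm L H))
        (QuantumSpaces.spatialNorm L E.subtype (QuantumSpaces.rowEmb H))
        (LinearMap.id : E ⊗[ℂ] H →ₗ[ℂ] E ⊗[ℂ] H) :=
  ⟨QuantumSpaces.isCompletelyIsometricIso_id QuantumSpaces.columnEmb_injective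
      Subtype.val_injective (QuantumSpaces.haagerupNorm_column hL E.subtype),
    QuantumSpaces.isCompletelyIsometricIso_id Subtype.val_injective
      QuantumSpaces.rowEmb_injective (QuantumSpaces.haagerupNorm_row hL E.subtype)⟩
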